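/- Let $d\ge 2$, $S^1=\mathbb R/2\pi\mathbb Z$, and let $W^{1,\infty}$ be the space of Lipschitz functions $c\colon S^1\to\mathbb R^d$ with the norm $\|c\|_{L^\infty}+\|c_\theta\|_{L^\infty}$, where $c_\theta$ is the (almost everywhere defined) derivative. Let $W^{1,\infty}_0=\{h\in W^{1,\infty}:\int_{S^1}h\,d\theta=0\}$, which is identified with $W^{1,\infty}$ modulo translations, and let $$\mathcal I^{1,\infty}_0=\{c\in W^{1,\infty}_0:\ \operatorname{ess\,inf}_\theta|c_\theta|>0\}$$ be the manifold of Lipschitz immersions modulo translations. For $c\in\mathcal I^{1,\infty}_0$ write $ds=|c_\theta|\,d\theta$, $D_s=|c_\theta|^{-1}\partial_\theta$, $\ell_c=\int_{S^1}ds$, and let $$G_c(h,k)=\frac1{\ell_c}\int_{S^1}\langle D_sh,D_sk\rangle\,ds,\qquad h,k\in W^{1,\infty}_0 .$$ Let $W^{0,\infty}=L^\infty(S^1,\mathbb R^d)$ and $W^{0,\infty}_0=\{k\in W^{0,\infty}:\int_{S^1}k\,ds=0\}$, let $\pi_0k=k-\frac1{\ell_c}\int_{S^1}k\,ds$ be the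 $L^2(ds)$-orthogonal projection of $W^{0,\infty}$ onto $W^{0,\infty}_0$, and let $D_s^{-1}\colon W^{0,\infty}_0\to W^{1,\infty}_0$ be the inverse of the linear bijection $D_s\colon W^{1,\infty}_0\to W^{0,\infty}_0$. For $c\in\mathcal I^{1,\infty}_0$ and $u\in W^{1,\infty}_0$ put $$\Gamma_c(u)=G_c(c,u)\,u-\tfrac12G_c(u,u)\,c+D_s^{-1}\pi_0\Big(\langle D_sc,D_su\rangle D_su-\tfrac12|D_su|^2D_sc\Big)\in W^{1,\infty}_0 .$$ Let $E(c)=\frac12\int_0^1G_c(c_t,c_t)\,dt$ be the Riemannian energy. **Theorem.** The geodesic equation of $G$ on $\mathcal I^{1,\infty}_0$ exists and is $c_{tt}=\Gamma_c(c_t)$. That is, for every $C^2$ path $c\colon[0,1]\to\mathcal I^{1,\infty}_0$ (with respect to the norm of $W^{1,\infty}$): 1. for every $C^1$ variation $h\colon[0,1]\to W^{1,\infty}_0$ with $h(0)=h(1)=0$, the function $\varepsilon\mapsto E(c+\varepsilon h)$ is differentiable at $\varepsilon=0$ with derivative $$dE(c).h=\int_0^1G_c\big(\Gamma_c(c_t)-c_{tt},\,h\big)\,dt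 ;$$ 2. $c$ is a critical point of the energy, i.e. $dE(c).h=0$ for all smooth $h\colon[0,1]\to W^{1,\infty}_0$ with $h(0)=h(1)=0$, if and only if for all $t\in[0,1]$ $$c_{tt}=G_c(c,c_t)\,c_t-\tfrac12G_c(c_t,c_t)\,c+D_s^{-1}\pi_0\Big(\langle D_sc,D_sc_t\rangle D_sc_t-\tfrac12|D_sc_t|^2D_sc\Big).$$ -/

import Mathlib

open Real MeasureTheory Set
open scoped ContDiff NNReal ENNReal RealInnerProductSpace

noncomputable section

namespace LipCurve

instance twoPiPos : Fact (0 < 2 * π) := ⟨Real.two_pi_pos⟩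

/-- The circle `ℝ / 2πℤ`; its `volume` is the measure `dθ` of total mass `2π`. -/
abbrev S1 : Type := AddCircle (2 * π)

abbrev Vec (d : ℕ) : Type := EuclideanSpace ℝ (Fin d)

variable {d : ℕ}

/-- The derivative `c_θ` of a function on the circle (zero where it does not exist). -/
def dTheta (c : S1 → Vec d) (x : S1) : Vec d :=
  deriv (fun y : ℝ => c (x + (y : S1))) 0

lemma lipschitz_coe : LipschitzWith 1 (fun t : ℝ => (t : S1)) := by
  refine LipschitzWith.of_dist_le_mul fun x y => ?_
  rw [dist_eq_norm, dist_eq_norm, ← AddCircle.coe_sub, NNReal.coe_one, one_mul]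
  exact QuotientAddGroup.norm_mk_le_norm

lemma dTheta_coe (c : S1 → Vec d) (t : ℝ) :
    dTheta c (t : S1) = deriv (fun y : ℝ => c (y : S1)) t := by
  have h := deriv_comp_const_add (f := fun y : ℝ => c (y : S1)) t 0
  simpa [dTheta] using h

lemma lipschitz_translate {K : ℝ≥0} {c : S1 → Vec d} (hc : LipschitzWith K c) (x : S1) :
    LipschitzWith K (fun y : ℝ => c (x + (y : S1))) := by
  have h : LipschitzWith 1 (fun y : ℝ => x + (y : S1)) := by
    refine LipschitzWith.of_dist_le_mul fun a b => ?_
    rw [dist_add_left]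
    exact lipschitz_coe.dist_le_mul a b
  simpa [Function.comp_def] using hc.comp h

lemma norm_dTheta_le {K : ℝ≥0} {c : S1 → Vec d} (hc : LipschitzWith K c) (x : S1) :
    ‖dTheta c x‖ ≤ K :=
  norm_deriv_le_of_lipschitz (lipschitz_translate hc x)

lemma measurable_dTheta {c : S1 → Vec d} (hc : Continuous c) : Measurable (dTheta c) := by
  have h := measurable_deriv_with_param (f := fun (x : S1) (y : ℝ) => c (x + (y : S1)))
    (by
      refine hc.comp ?_
      exact continuous_fst.add ((AddCircle.continuous_mk' _).comp continuous_snd))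
  exact h.comp (measurable_id.prodMk measurable_const)

lemma ae_circle_of_ae_real {p : S1 → Prop} (h : ∀ᵐ t : ℝ, p (t : S1)) : ∀ᵐ x : S1, p x := by
  have h1 := AddCircle.measurePreserving_equivIoc (2 * π) (a := 0)
  have h2 : ∀ᵐ (s : Ioc (0 : ℝ) (0 + 2 * π)) ∂(Measure.comap (Subtype.val : Ioc (0 : ℝ) (0 + 2 * π) → ℝ) volume :
      Measure (Ioc (0 : ℝ) (0 + 2 * π))), p ((s : ℝ) : S1) := by
    have := (measurePreserving_subtype_coe
      (measurableSet_Ioc (a := (0 : ℝ)) (b := 0 + 2 * π)) (μa := volume)).quasiMeasurePreserving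
    exact this.ae (ae_restrict_of_ae h)
  filter_upwards [h1.quasiMeasurePreserving.ae h2] with x hx
  have : (((AddCircle.equivIoc (2 * π) 0 x : Ioc (0 : ℝ) (0 + 2 * π)) : ℝ) : S1) = x :=
    (AddCircle.equivIoc (2 * π) 0).symm_apply_apply x
  rwa [this] at hx

lemma ae_real_of_ae_circle {p : S1 → Prop} (h : ∀ᵐ x : S1, p x) : ∀ᵐ t : ℝ, p (t : S1) := by
  have h1 : ∀ n : ℤ, ∀ᵐ t ∂(volume.restrict (Ioc (n • (2 * π)) ((n + 1) • (2 * π)))),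
      p ((t : ℝ) : S1) := by
    intro n
    have := (AddCircle.measurePreserving_mk (2 * π) (n • (2 * π))).quasiMeasurePreserving.ae h
    rwa [add_smul, one_smul]
  have h2 := (ae_restrict_iUnion_iff (μ := (volume : Measure ℝ)) _ (fun t => p ((t : ℝ) : S1))).2 h1
  rwa [iUnion_Ioc_zsmul Real.two_pi_pos, Measure.restrict_univ] at h2

lemma ae_differentiableAt_translate {K : ℝ≥0} {c : S1 → Vec d} (hc : LipschitzWith K c) :
    ∀ᵐ x : S1, DifferentiableAt ℝ (fun y : ℝ => c (x + (y : S1))) 0 := by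
  have h0 : LipschitzWith K (fun y : ℝ => c (y : S1)) := by
    simpa using lipschitz_translate hc 0
  refine ae_circle_of_ae_real ?_
  filter_upwards [h0.ae_differentiableAt_real] with t ht
  have : DifferentiableAt ℝ (fun y : ℝ => (fun z : ℝ => c (z : S1)) (t + y)) 0 := by
    refine DifferentiableAt.comp (0 : ℝ) (f := fun y : ℝ => t + y) (by simpa using ht) ?_
    exact differentiableAt_id.const_add t
  simpa using this

lemma dTheta_add_ae {K L : ℝ≥0} {c e : S1 → Vec d} (hc : LipschitzWith K c)
    (he : LipschitzWith L e) : dTheta (c + e) =ᵐ[volume] dTheta c + dTheta e := by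
  filter_upwards [ae_differentiableAt_translate hc, ae_differentiableAt_translate he]
    with x h1 h2
  exact deriv_add h1 h2

lemma dTheta_smul (a : ℝ) (c : S1 → Vec d) : dTheta (a • c) = a • dTheta c := by
  funext x
  exact deriv_const_smul_field a (fun y : ℝ => c (x + (y : S1)))

lemma integral_dTheta_eq {K : ℝ≥0} {c : S1 → Vec d} (hc : LipschitzWith K c) (t : ℝ) :
    ∫ u in (0 : ℝ)..t, dTheta c (u : S1) = c (t : S1) - c ((0 : ℝ) : S1) := by
  have h0 : LipschitzWith K (fun y : ℝ => c (y : S1)) := by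
    simpa using lipschitz_translate hc 0
  have hm : Measurable (fun u : ℝ => dTheta c (u : S1)) :=
    (measurable_dTheta hc.continuous).comp AddCircle.measurable_mk'
  have hint : ∀ a b : ℝ, IntervalIntegrable (fun u : ℝ => dTheta c (u : S1)) volume a b := by
    intro a b
    refine (intervalIntegrable_const (c := (K : ℝ))).mono_fun hm.aestronglyMeasurable ?_
    refine Filter.Eventually.of_forall fun u => ?_
    simpa using norm_dTheta_le hc (u : S1)
  have hloc : LocallyIntegrable (fun u : ℝ => dTheta c (u : S1)) volume := by
    refine (locallyIntegrable_const (K : ℝ)).mono hm.aestronglyMeasurable ?_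
    refine Filter.Eventually.of_forall fun u => ?_
    simpa using norm_dTheta_le hc (u : S1)
  set F : ℝ → Vec d := fun t => c (t : S1) - ∫ u in (0 : ℝ)..t, dTheta c (u : S1) with hF
  have hI : LipschitzWith K (fun t : ℝ => ∫ u in (0 : ℝ)..t, dTheta c (u : S1)) := by
    refine LipschitzWith.of_dist_le_mul fun a b => ?_
    rw [dist_eq_norm, intervalIntegral.integral_interval_sub_left (hint _ _) (hint _ _),
      Real.dist_eq]
    exact intervalIntegral.norm_integral_le_of_norm_le_const
      fun u _ => norm_dTheta_le hc (u : S1)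
  have hFL : LipschitzWith (K + K) F := h0.sub hI
  have hd : ∀ᵐ x : ℝ, x ∈ uIcc 0 t → HasDerivAt F 0 x := by
    filter_upwards [h0.ae_differentiableAt_real, LocallyIntegrable.ae_hasDerivAt_integral hloc] with x h1 h2 _
    have h3 := h1.hasDerivAt.sub (h2 0)
    rw [← dTheta_coe, sub_self] at h3
    exact h3
  obtain ⟨C, hC⟩ :=
    (hFL.lipschitzOnWith (s := uIcc 0 t)).absolutelyContinuousOnInterval.const_of_ae_hasDerivAt_zero
      hd
  have h1 := hC 0 left_mem_uIcc
  have h2 := hC t right_mem_uIcc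
  rw [← h1] at h2
  simp only [hF, intervalIntegral.integral_same, sub_zero] at h2
  rw [← h2]; abel

/-- A bounded measurable function on the circle with vanishing integral has a Lipschitz
primitive. -/
lemma exists_primitive {C : ℝ≥0} {f : S1 → Vec d} (hf : Measurable f) (hb : ∀ x, ‖f x‖ ≤ C)
    (h0 : ∫ x, f x = 0) : ∃ h : S1 → Vec d, LipschitzWith C h ∧ dTheta h =ᵐ[volume] f := by
  have hm : Measurable (fun u : ℝ => f (u : S1)) := hf.comp AddCircle.measurable_mk'
  have hint : ∀ a b : ℝ, IntervalIntegrable (fun u : ℝ => f (u : S1)) volume a b := by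
    intro a b
    refine (intervalIntegrable_const (c := (C : ℝ))).mono_fun hm.aestronglyMeasurable ?_
    exact Filter.Eventually.of_forall fun u => by simpa using hb (u : S1)
  have hloc : LocallyIntegrable (fun u : ℝ => f (u : S1)) volume := by
    refine (locallyIntegrable_const (C : ℝ)).mono hm.aestronglyMeasurable ?_
    exact Filter.Eventually.of_forall fun u => by simpa using hb (u : S1)
  set H : ℝ → Vec d := fun t => ∫ u in (0 : ℝ)..t, f (u : S1) with hH
  have hper : Function.Periodic H (2 * π) := by
    intro t
    have h1 := intervalIntegral.integral_interval_sub_left (hint 0 (t + 2 * π)) (hint 0 t)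
    rw [AddCircle.intervalIntegral_preimage, h0, sub_eq_zero] at h1
    exact h1
  have hHL : ∀ a b : ℝ, ‖H a - H b‖ ≤ C * |a - b| := by
    intro a b
    rw [hH, intervalIntegral.integral_interval_sub_left (hint _ _) (hint _ _)]
    exact intervalIntegral.norm_integral_le_of_norm_le_const fun u _ => hb (u : S1)
  have hlift : ∀ t : ℝ, hper.lift (t : S1) = H t := fun t => hper.lift_coe t
  refine ⟨hper.lift, ?_, ?_⟩
  · refine LipschitzWith.of_dist_le_mul fun x y => ?_
    induction x using QuotientAddGroup.induction_on with | H a => ?_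
    induction y using QuotientAddGroup.induction_on with | H b => ?_
    have hper' := (hper.int_mul (round ((2 * π)⁻¹ * (a - b)))).sub_eq a
    change dist (hper.lift (a : S1)) (hper.lift (b : S1)) ≤ C * dist (a : S1) (b : S1)
    rw [hlift, hlift, dist_eq_norm, dist_eq_norm, ← AddCircle.coe_sub, AddCircle.norm_eq,
      ← hper']
    refine (hHL _ _).trans (le_of_eq ?_)
    congr 2
    ring
  · refine ae_circle_of_ae_real ?_
    filter_upwards [LocallyIntegrable.ae_hasDerivAt_integral hloc] with t ht
    rw [dTheta_coe]
    simp only [hlift]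
    exact (ht 0).deriv

/-- The Lipschitz functions `S¹ → ℝᵈ`. -/
def lipschitzFunctions (d : ℕ) : Submodule ℝ (S1 → Vec d) where
  carrier := {c | ∃ K : ℝ≥0, LipschitzWith K c}
  zero_mem' := ⟨0, LipschitzWith.const 0⟩
  add_mem' := by
    rintro a b ⟨K, hK⟩ ⟨L, hL⟩
    exact ⟨K + L, hK.add hL⟩
  smul_mem' := by
    rintro a c ⟨K, hK⟩
    exact ⟨‖a‖₊ * K, (lipschitzWith_smul a).comp hK⟩

/-- The space `W^{1,∞}(S¹, ℝᵈ)`. -/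
def W1 (d : ℕ) : Type := lipschitzFunctions d

namespace W1

instance : AddCommGroup (W1 d) := inferInstanceAs (AddCommGroup (lipschitzFunctions d))

instance : Module ℝ (W1 d) := inferInstanceAs (Module ℝ (lipschitzFunctions d))

instance : CoeFun (W1 d) (fun _ => S1 → Vec d) := ⟨fun c => Subtype.val c⟩

lemma coe_add (c e : W1 d) : ((c + e : W1 d) : S1 → Vec d) = (c : S1 → Vec d) + e := rfl

lemma coe_smul (a : ℝ) (c : W1 d) : ((a • c : W1 d) : S1 → Vec d) = a • (c : S1 → Vec d) := rfl

lemma exists_lipschitz (c : W1 d) : ∃ K : ℝ≥0, LipschitzWith K (c : S1 → Vec d) := c.2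

lemma continuous (c : W1 d) : Continuous (c : S1 → Vec d) :=
  c.exists_lipschitz.choose_spec.continuous

lemma memLp_dTheta (c : W1 d) : MemLp (dTheta c) ∞ (volume : Measure S1) := by
  obtain ⟨K, hK⟩ := c.exists_lipschitz
  exact memLp_top_of_bound (measurable_dTheta c.continuous).aestronglyMeasurable K
    (Filter.Eventually.of_forall (norm_dTheta_le hK))

lemma dTheta_add (c e : W1 d) : dTheta (c + e : W1 d) =ᵐ[volume] dTheta c + dTheta e := by
  obtain ⟨K, hK⟩ := c.exists_lipschitz
  obtain ⟨L, hL⟩ := e.exists_lipschitz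
  exact dTheta_add_ae hK hL

/-- `c ↦ (c, c_θ)`, with values in the `ℓ¹`-product of `C(S¹, ℝᵈ)` and `L^∞(S¹, ℝᵈ)`. -/
def graphMap (d : ℕ) : W1 d →ₗ[ℝ] WithLp 1 (C(S1, Vec d) × Lp (Vec d) ∞ (volume : Measure S1)) where
  toFun c := WithLp.toLp 1 (⟨c, c.continuous⟩, c.memLp_dTheta.toLp _)
  map_add' c e := by
    rw [← WithLp.toLp_add]
    congr 1
    refine Prod.ext rfl ?_
    exact (MemLp.toLp_congr (c + e).memLp_dTheta (c.memLp_dTheta.add e.memLp_dTheta) (dTheta_add c e)).trans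
      (MemLp.toLp_add c.memLp_dTheta e.memLp_dTheta)
  map_smul' a c := by
    rw [RingHom.id_apply, ← WithLp.toLp_smul]
    congr 1
    refine Prod.ext rfl ?_
    refine (MemLp.toLp_congr (a • c).memLp_dTheta (c.memLp_dTheta.const_smul a) ?_).trans
      (MemLp.toLp_const_smul a c.memLp_dTheta)
    exact Filter.EventuallyEq.of_eq (dTheta_smul a c)

lemma graphMap_injective (d : ℕ) : Function.Injective (graphMap d) := by
  intro c e h
  have h1 : (⟨c, c.continuous⟩ : C(S1, Vec d)) = ⟨e, e.continuous⟩ :=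
    congrArg (fun p => (WithLp.ofLp p).1) h
  exact Subtype.ext (congrArg (fun f : C(S1, Vec d) => (f : S1 → Vec d)) h1)

/-- The norm `‖c‖_{L^∞} + ‖c_θ‖_{L^∞}`. -/
instance : NormedAddCommGroup (W1 d) :=
  NormedAddCommGroup.induced _ _ (graphMap d) (graphMap_injective d)

instance : NormedSpace ℝ (W1 d) := NormedSpace.induced ℝ _ _ (graphMap d)

lemma norm_def (c : W1 d) : ‖c‖ = ‖(⟨c, c.continuous⟩ : C(S1, Vec d))‖ +
    (eLpNorm (dTheta c) ∞ (volume : Measure S1)).toReal := by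
  change ‖graphMap d c‖ = _
  rw [WithLp.prod_norm_eq_of_L1]
  congr 1
  exact Lp.norm_toLp _ c.memLp_dTheta

end W1

/-- The subspace `W^{1,∞}_0` of functions with `∫ h dθ = 0`, identified with `W^{1,∞}` modulo
translations. -/
def W10 (d : ℕ) : Submodule ℝ (W1 d) where
  carrier := {h | ∫ x, h x = 0}
  zero_mem' := by
    change ∫ _ : S1, (0 : Vec d) = 0
    simp
  add_mem' := by
    intro a b (ha : _ = _) (hb : _ = _)
    change ∫ x, (a x + b x) = 0
    rw [integral_add, ha, hb, add_zero]
    · exact a.continuous.integrable_of_hasCompactSupport (HasCompactSupport.of_compactSpace _)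
    · exact b.continuous.integrable_of_hasCompactSupport (HasCompactSupport.of_compactSpace _)
  smul_mem' := by
    intro r a (ha : _ = _)
    change ∫ x, r • a x = 0
    rw [integral_smul, ha, smul_zero]

/-- Lipschitz immersions: `essinf |c_θ| > 0`. -/
def IsImmersion (c : W1 d) : Prop :=
  0 < essInf (fun x => ‖dTheta c x‖) (volume : Measure S1)

/-- The manifold `I^{1,∞}_0` of Lipschitz immersions with mean zero, a subset of `W^{1,∞}_0`. -/
def Imm0 (d : ℕ) : Set (W10 d) := {c | IsImmersion (c : W1 d)}

/-- Integration `∫ f ds` with respect to the arc length `ds = |c_θ| dθ` of `c`. -/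
def arcInt {F : Type*} [NormedAddCommGroup F] [NormedSpace ℝ F] (c : W1 d) (f : S1 → F) : F :=
  ∫ x, ‖dTheta c x‖ • f x

/-- The length `ℓ_c`. -/
def len (c : W1 d) : ℝ := arcInt c (fun _ => (1 : ℝ))

/-- The arc length derivative `D_s h = |c_θ|⁻¹ h_θ`, as a function on the circle. -/
def arcDeriv (c h : W1 d) (x : S1) : Vec d := ‖dTheta c x‖⁻¹ • dTheta h x

/-- The metric `G_c(h, k) = ℓ_c⁻¹ ∫ ⟨D_s h, D_s k⟩ ds`. -/
def G (c h k : W1 d) : ℝ :=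
  (len c)⁻¹ * arcInt c (fun x => ⟪arcDeriv c h x, arcDeriv c k x⟫)

/-- The space `W^{0,∞} = L^∞(S¹, ℝᵈ)`. -/
abbrev W0 (d : ℕ) : Type := Lp (Vec d) ∞ (volume : Measure S1)

lemma W1.norm_dTheta_memLp (c : W1 d) :
    MemLp (fun x => ‖dTheta c x‖) ∞ (volume : Measure S1) := c.memLp_dTheta.norm

lemma integrable_arc (c : W1 d) (k : W0 d) : Integrable (fun x => ‖dTheta c x‖ • k x) volume :=
  ((Lp.memLp k).smul c.norm_dTheta_memLp (r := ∞)).integrable le_top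

/-- The subspace `W^{0,∞}_0` of those `k` in `W^{0,∞}` with `∫ k ds = 0`; it depends on `c`. -/
def W00 (c : W1 d) : Submodule ℝ (W0 d) where
  carrier := {k | arcInt c k = 0}
  zero_mem' := by
    change ∫ x, ‖dTheta c x‖ • (0 : W0 d) x = 0
    rw [integral_congr_ae (g := fun _ => (0 : Vec d)), integral_zero]
    filter_upwards [Lp.coeFn_zero (Vec d) ∞ (volume : Measure S1)] with x hx
    rw [hx, Pi.zero_apply, smul_zero]
  add_mem' := by
    intro a b (ha : _ = _) (hb : _ = _)
    change ∫ x, ‖dTheta c x‖ • (a + b) x = 0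
    rw [integral_congr_ae (g := fun x => ‖dTheta c x‖ • a x + ‖dTheta c x‖ • b x),
      integral_add (integrable_arc c a) (integrable_arc c b)]
    · unfold arcInt at ha hb
      rw [ha, hb, add_zero]
    · filter_upwards [Lp.coeFn_add a b] with x hx
      rw [hx, Pi.add_apply, smul_add]
  smul_mem' := by
    intro r a (ha : _ = _)
    change ∫ x, ‖dTheta c x‖ • (r • a) x = 0
    rw [integral_congr_ae (g := fun x => r • (‖dTheta c x‖ • a x)), integral_smul]
    · unfold arcInt at ha
      rw [ha, smul_zero]
    · filter_upwards [Lp.coeFn_smul r a] with x hx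
      rw [hx, Pi.smul_apply, smul_comm r]

lemma arcInt_const (c : W1 d) (v : Vec d) : arcInt c (fun _ => v) = len c • v := by
  unfold arcInt len arcInt
  rw [integral_smul_const]
  simp

lemma arcInt_eq_zero_of_len (c : W1 d) (hc : len c = 0) (k : S1 → Vec d) : arcInt c k = 0 := by
  have h : ∫ x, ‖dTheta c x‖ = 0 := by simpa [len, arcInt] using hc
  rw [integral_eq_zero_iff_of_nonneg (fun x => norm_nonneg _)
    (c.norm_dTheta_memLp.integrable le_top)] at h
  unfold arcInt
  rw [integral_congr_ae (g := fun _ => (0 : Vec d)), integral_zero]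
  filter_upwards [h] with x hx
  rw [hx]; simp

/-- The `L²(ds)`-orthogonal projection `π₀ k = k - ℓ_c⁻¹ ∫ k ds` of `W^{0,∞}` onto `W^{0,∞}_0`. -/
def proj0 (c : W1 d) (k : W0 d) : W00 c :=
  ⟨k - Lp.const ∞ volume ((len c)⁻¹ • arcInt c k), by
    change ∫ x, ‖dTheta c x‖ • (k - Lp.const ∞ volume ((len c)⁻¹ • arcInt c k) : W0 d) x = 0
    have hi := integrable_arc c (Lp.const ∞ volume ((len c)⁻¹ • arcInt c k) : W0 d)
    rw [integral_congr_ae (g := fun x => ‖dTheta c x‖ • k x -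
        ‖dTheta c x‖ • (Lp.const ∞ volume ((len c)⁻¹ • arcInt c k) : W0 d) x),
      integral_sub (integrable_arc c k) hi]
    · have h1 : ∫ x, ‖dTheta c x‖ • (Lp.const ∞ volume ((len c)⁻¹ • arcInt c k) : W0 d) x =
          arcInt c (fun _ => (len c)⁻¹ • arcInt c k) := by
        refine integral_congr_ae ?_
        filter_upwards [Lp.coeFn_const (E := Vec d) (p := ∞) (μ := (volume : Measure S1))
          ((len c)⁻¹ • arcInt c k)] with x hx
        rw [hx]; rfl
      rw [h1, arcInt_const, smul_smul]
      by_cases h0 : len c = 0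
      · have := arcInt_eq_zero_of_len c h0 k
        rw [this, smul_zero, sub_zero]
        exact this
      · rw [mul_inv_cancel₀ h0, one_smul]
        exact sub_self _
    · filter_upwards [Lp.coeFn_sub k (Lp.const ∞ volume ((len c)⁻¹ • arcInt c k) : W0 d)]
        with x hx
      rw [hx, Pi.sub_apply, smul_sub]⟩

lemma proj0_coe_ae (c : W1 d) (k : W0 d) :
    ∀ᵐ x : S1, (proj0 c k : W0 d) x = k x - (len c)⁻¹ • arcInt c k := by
  filter_upwards [Lp.coeFn_sub k (Lp.const ∞ volume ((len c)⁻¹ • arcInt c k) : W0 d),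
    Lp.coeFn_const (E := Vec d) (p := ∞) (μ := (volume : Measure S1))
      ((len c)⁻¹ • arcInt c k)] with x h1 h2
  change (k - Lp.const ∞ volume ((len c)⁻¹ • arcInt c k) : W0 d) x = _
  rw [h1, Pi.sub_apply, h2]
  rfl

/-- The map `proj0 c` is the orthogonal projection for the `L²(ds)` inner product. -/
lemma proj0_orthogonal (c : W1 d) (k : W0 d) (m : W00 c) :
    arcInt c (fun x => ⟪k x - (proj0 c k : W0 d) x, (m : W0 d) x⟫) = 0 := by
  have h : ∀ᵐ x : S1, ‖dTheta c x‖ • ⟪k x - (proj0 c k : W0 d) x, (m : W0 d) x⟫ =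
      ⟪(len c)⁻¹ • arcInt c k, ‖dTheta c x‖ • (m : W0 d) x⟫ := by
    filter_upwards [proj0_coe_ae c k] with x hx
    rw [hx, sub_sub_cancel, inner_smul_right, smul_eq_mul]
  have hm : ∫ x, ‖dTheta c x‖ • (m : W0 d) x = 0 := m.2
  unfold arcInt
  rw [integral_congr_ae h, integral_inner (integrable_arc c m), hm, inner_zero_right]

lemma IsImmersion.exists_bound {c : W1 d} (hc : IsImmersion c) :
    ∃ δ : ℝ, 0 < δ ∧ ∀ᵐ x : S1, δ < ‖dTheta c x‖ := by
  have hc' : 0 < essInf (fun x => ‖dTheta c x‖) (volume : Measure S1) := hc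
  refine ⟨essInf (fun x => ‖dTheta c x‖) (volume : Measure S1) / 2, half_pos hc', ?_⟩
  obtain ⟨K, hK⟩ := c.exists_lipschitz
  refine ae_lt_of_lt_essInf (half_lt_self hc') ?_
  exact Filter.isBoundedUnder_of ⟨0, fun x => norm_nonneg _⟩

lemma memLp_arcDeriv {c : W1 d} (hc : IsImmersion c) (h : W1 d) :
    MemLp (arcDeriv c h) ∞ (volume : Measure S1) := by
  obtain ⟨δ, hδ, hb⟩ := hc.exists_bound
  have h1 : MemLp (fun x => ‖dTheta c x‖⁻¹) ∞ (volume : Measure S1) := by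
    refine memLp_top_of_bound
      (measurable_dTheta c.continuous).norm.inv.aestronglyMeasurable δ⁻¹ ?_
    filter_upwards [hb] with x hx
    rw [norm_inv, norm_norm]
    exact inv_anti₀ hδ hx.le
  have h2 : MemLp ((fun x => ‖dTheta c x‖⁻¹) • dTheta h) ∞ (volume : Measure S1) :=
    MemLp.smul (p := ∞) (q := ∞) h.memLp_dTheta h1
  exact h2

lemma arc_smul_arcDeriv {c : W1 d} (hc : IsImmersion c) (h : W1 d) :
    ∀ᵐ x : S1, ‖dTheta c x‖ • arcDeriv c h x = dTheta h x := by
  obtain ⟨δ, hδ, hb⟩ := hc.exists_bound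
  filter_upwards [hb] with x hx
  rw [arcDeriv, smul_smul, mul_inv_cancel₀ (hδ.trans hx).ne', one_smul]

lemma W1.integral_dTheta (h : W1 d) : ∫ x, dTheta h x = 0 := by
  obtain ⟨K, hK⟩ := h.exists_lipschitz
  rw [← AddCircle.intervalIntegral_preimage (2 * π) 0, zero_add, integral_dTheta_eq hK, AddCircle.coe_period, AddCircle.coe_zero, sub_self]

/-- The operator `D_s : W^{1,∞}_0 → W^{0,∞}_0` of an immersion `c`. -/
def Ds (c : W1 d) (hc : IsImmersion c) : W10 d →ₗ[ℝ] W00 c where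
  toFun h := ⟨(memLp_arcDeriv hc h).toLp _, by
    change ∫ x, ‖dTheta c x‖ • (memLp_arcDeriv hc h).toLp _ x = 0
    rw [integral_congr_ae (g := dTheta h), W1.integral_dTheta]
    filter_upwards [(memLp_arcDeriv hc h).coeFn_toLp, arc_smul_arcDeriv hc h] with x h1 h2
    rw [h1, h2]⟩
  map_add' h k := by
    refine Subtype.ext ?_
    refine (MemLp.toLp_congr (memLp_arcDeriv hc (h + k : W10 d))
      ((memLp_arcDeriv hc h).add (memLp_arcDeriv hc k)) ?_).trans
      (MemLp.toLp_add (memLp_arcDeriv hc h) (memLp_arcDeriv hc k))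
    filter_upwards [W1.dTheta_add (h : W1 d) (k : W1 d)] with x hx
    change ‖dTheta c x‖⁻¹ • dTheta ((h : W1 d) + (k : W1 d) : W1 d) x = _
    rw [hx, Pi.add_apply, smul_add]
    rfl
  map_smul' a h := by
    refine Subtype.ext ?_
    refine (MemLp.toLp_congr (memLp_arcDeriv hc (a • h : W10 d))
      ((memLp_arcDeriv hc h).const_smul a) ?_).trans
      (MemLp.toLp_const_smul a (memLp_arcDeriv hc h))
    refine Filter.Eventually.of_forall fun x => ?_
    change ‖dTheta c x‖⁻¹ • dTheta (a • ((h : W1 d) : S1 → Vec d)) x = _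
    rw [dTheta_smul]
    exact smul_comm (‖dTheta c x‖⁻¹) a (dTheta (h : W1 d) x)

lemma Ds_coe_ae (c : W1 d) (hc : IsImmersion c) (h : W10 d) :
    ((Ds c hc h : W0 d) : S1 → Vec d) =ᵐ[volume] arcDeriv c h :=
  (memLp_arcDeriv hc h).coeFn_toLp

lemma W0.exists_bound (k : W0 d) : ∃ C : ℝ≥0, ∀ᵐ x, ‖k x‖ ≤ C := by
  have h1 := (Lp.memLp k).eLpNorm_lt_top
  rw [eLpNorm_exponent_top] at h1
  refine ⟨(eLpNormEssSup k volume).toNNReal, ?_⟩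
  filter_upwards [ae_le_eLpNormEssSup (f := k) (μ := (volume : Measure S1))] with x hx
  rw [← coe_nnnorm, NNReal.coe_le_coe]
  exact ENNReal.le_toNNReal_of_coe_le hx h1.ne

lemma W10.eq_zero_of_dTheta (h : W10 d) (h0 : ∀ᵐ x : S1, dTheta (h : W1 d) x = 0) : h = 0 := by
  obtain ⟨K, hK⟩ := (h : W1 d).exists_lipschitz
  have hconst : ∀ t : ℝ, (h : W1 d) (t : S1) = (h : W1 d) ((0 : ℝ) : S1) := by
    intro t
    have h1 := integral_dTheta_eq hK t
    rw [intervalIntegral.integral_congr_ae (g := fun _ => (0 : Vec d)),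
      intervalIntegral.integral_zero] at h1
    · exact (sub_eq_zero.1 h1.symm)
    · filter_upwards [ae_real_of_ae_circle h0] with t ht _ using ht
  have hc : ((h : W1 d) : S1 → Vec d) = fun _ => (h : W1 d) ((0 : ℝ) : S1) := by
    funext x
    induction x using QuotientAddGroup.induction_on with | H a => exact hconst a
  have hi : ∫ x, (h : W1 d) x = 0 := h.2
  rw [hc, integral_const] at hi
  have hz : (h : W1 d) ((0 : ℝ) : S1) = 0 := by
    refine (smul_eq_zero.1 hi).resolve_left ?_
    have : (volume : Measure S1).real univ = 2 * π := by
      rw [Measure.real, AddCircle.measure_univ, ENNReal.toReal_ofReal Real.two_pi_pos.le]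
    rw [this]
    exact Real.two_pi_pos.ne'
  refine Subtype.ext (Subtype.ext ?_)
  rw [hz] at hc
  exact hc

lemma Ds_bijective (c : W1 d) (hc : IsImmersion c) : Function.Bijective (Ds c hc) := by
  constructor
  · rw [← LinearMap.ker_eq_bot, LinearMap.ker_eq_bot']
    intro h hh
    refine W10.eq_zero_of_dTheta h ?_
    have h1 := Ds_coe_ae c hc h
    rw [hh] at h1
    filter_upwards [h1, Lp.coeFn_zero (Vec d) ∞ (volume : Measure S1),
      arc_smul_arcDeriv hc (h : W1 d)] with x h2 h3 h4
    rw [← h4, ← h2]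
    change ‖dTheta c x‖ • (0 : W0 d) x = 0
    rw [h3]; simp
  · intro k
    obtain ⟨K, hK⟩ := c.exists_lipschitz
    -- a bounded measurable representative of `|c_θ| k`
    have hks : StronglyMeasurable ((k : W0 d) : S1 → Vec d) := Lp.stronglyMeasurable _
    obtain ⟨C, hkb⟩ := W0.exists_bound (k : W0 d)
    set A : Set S1 := {x | ‖(k : W0 d) x‖ ≤ C} with hA
    set f : S1 → Vec d := A.indicator
      (fun x => ‖dTheta c x‖ • (k : W0 d) x) with hf
    have hfm : Measurable f :=
      ((measurable_dTheta c.continuous).norm.smul hks.measurable).indicator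
        (measurableSet_le hks.measurable.norm measurable_const)
    have hfk : f =ᵐ[volume] fun x => ‖dTheta c x‖ • (k : W0 d) x := by
      filter_upwards [hkb] with x hx
      exact indicator_of_mem (s := A) hx _
    have hfb : ∀ x, ‖f x‖ ≤ (K * C : ℝ≥0) := by
      intro x
      rw [NNReal.coe_mul]
      by_cases hx : ‖(k : W0 d) x‖ ≤ C
      · have : f x = ‖dTheta c x‖ • (k : W0 d) x := indicator_of_mem (s := A) hx _
        rw [this, norm_smul, norm_norm]
        exact mul_le_mul (norm_dTheta_le hK x) hx (norm_nonneg _) K.2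
      · have : f x = 0 := indicator_of_notMem (s := A) hx _
        rw [this, norm_zero]
        positivity
    have hf0 : ∫ x, f x = 0 := by
      rw [integral_congr_ae hfk]
      exact k.2
    obtain ⟨h, hL, hh⟩ := exists_primitive hfm hfb hf0
    set m : Vec d := (2 * π)⁻¹ • ∫ x, h x with hm
    have hL' : LipschitzWith (K * C) (fun x => h x - m) := by
      simpa using hL.sub (LipschitzWith.const m)
    have hdh : dTheta (fun x => h x - m) = dTheta h := by
      funext x
      exact deriv_sub_const _
    let h' : W10 d := ⟨⟨fun x => h x - m, _, hL'⟩, by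
      change ∫ x, (h x - m) = 0
      rw [integral_sub (hL.continuous.integrable_of_hasCompactSupport
        (HasCompactSupport.of_compactSpace _)) (integrable_const _), integral_const]
      have : (volume : Measure S1).real univ = 2 * π := by
        rw [Measure.real, AddCircle.measure_univ, ENNReal.toReal_ofReal Real.two_pi_pos.le]
      rw [this, hm, smul_smul, mul_inv_cancel₀ Real.two_pi_pos.ne', one_smul, sub_self]⟩
    refine ⟨h', Subtype.ext (Lp.ext ?_)⟩
    obtain ⟨δ, hδ, hb⟩ := hc.exists_bound
    filter_upwards [Ds_coe_ae c hc h', hh, hfk, hb] with x h1 h2 h3 h4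
    rw [h1]
    change ‖dTheta c x‖⁻¹ • dTheta (fun x => h x - m) x = _
    rw [hdh, h2, h3, smul_smul, inv_mul_cancel₀ (hδ.trans h4).ne', one_smul]

/-- `D_s` as a linear isomorphism from `W^{1,∞}_0` onto `W^{0,∞}_0`. -/
def DsEquiv (c : W1 d) (hc : IsImmersion c) : W10 d ≃ₗ[ℝ] W00 c :=
  LinearEquiv.ofBijective (Ds c hc) (Ds_bijective c hc)

/-- The function `⟨D_s c, D_s u⟩ D_s u - ½ |D_s u|² D_s c`. -/
def geoDensity (c u : W1 d) (x : S1) : Vec d :=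
  ⟪arcDeriv c c x, arcDeriv c u x⟫ • arcDeriv c u x -
    ((1 / 2 : ℝ) * ‖arcDeriv c u x‖ ^ 2) • arcDeriv c c x

lemma memLp_geoDensity {c : W1 d} (hc : IsImmersion c) (u : W1 d) :
    MemLp (geoDensity c u) ∞ (volume : Measure S1) := by
  have h1 := memLp_arcDeriv hc c
  have h2 := memLp_arcDeriv hc u
  have h3 : MemLp (fun x => ⟪arcDeriv c c x, arcDeriv c u x⟫) ∞ (volume : Measure S1) := by
    have h5 : MemLp (fun x => ‖arcDeriv c u x‖ * ‖arcDeriv c c x‖) ∞ (volume : Measure S1) :=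
      MemLp.mul' (p := ∞) (q := ∞) h1.norm h2.norm
    refine h5.of_le (h1.aestronglyMeasurable.inner h2.aestronglyMeasurable) ?_
    refine Filter.Eventually.of_forall fun x => ?_
    rw [norm_mul, norm_norm, norm_norm, mul_comm]
    exact norm_inner_le_norm _ _
  have h4 : MemLp (fun x => (1 / 2 : ℝ) * ‖arcDeriv c u x‖ ^ 2) ∞ (volume : Measure S1) := by
    simp_rw [sq]
    have h5 : MemLp (fun x => ‖arcDeriv c u x‖ * ‖arcDeriv c u x‖) ∞ (volume : Measure S1) :=
      MemLp.mul' (p := ∞) (q := ∞) h2.norm h2.norm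
    exact h5.const_mul _
  have h5 : MemLp ((fun x => ⟪arcDeriv c c x, arcDeriv c u x⟫) • arcDeriv c u) ∞
      (volume : Measure S1) := MemLp.smul (p := ∞) (q := ∞) h2 h3
  have h6 : MemLp ((fun x => (1 / 2 : ℝ) * ‖arcDeriv c u x‖ ^ 2) • arcDeriv c c) ∞
      (volume : Measure S1) := MemLp.smul (p := ∞) (q := ∞) h1 h4
  exact h5.sub h6

/-- The right-hand side of the geodesic equation,
`G_c(c,u) u - ½ G_c(u,u) c + D_s⁻¹ π₀ (⟨D_s c, D_s u⟩ D_s u - ½ |D_s u|² D_s c)`. -/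
def geodesicRHS (c : Imm0 d) (u : W10 d) : W10 d :=
  G (d := d) c.1 c.1 u • u - ((1 / 2 : ℝ) * G (d := d) c.1 u u) • c.1 +
    (DsEquiv c.1.1 c.2).symm (proj0 c.1.1 ((memLp_geoDensity c.2 u.1).toLp _))

/-- The velocity of a path defined on `[0, 1]`. -/
def velocity (c : ℝ → W10 d) (t : ℝ) : W10 d := derivWithin c (Icc 0 1) t

/-- The second time derivative of a path defined on `[0, 1]`. -/
def acceleration (c : ℝ → W10 d) (t : ℝ) : W10 d := derivWithin (velocity c) (Icc 0 1) t

/-- The Riemannian energy `E(c) = ½ ∫₀¹ G_c(c_t, c_t) dt` of a path on `[0, 1]`. -/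
def energy (c : ℝ → W10 d) : ℝ :=
  (1 / 2 : ℝ) * ∫ t in (0 : ℝ)..1, G (d := d) (c t) (velocity c t) (velocity c t)

/-- A path in `I^{1,∞}_0` is a critical point of the energy (a geodesic) if `dE(c).h = 0` for all
smooth variations `h` with `h(0) = h(1) = 0`. -/
def IsGeodesic (c : ℝ → Imm0 d) : Prop :=
  ∀ h : ℝ → W10 d, ContDiffOn ℝ ∞ h (Icc 0 1) → h 0 = 0 → h 1 = 0 →
    HasDerivAt (fun ε : ℝ => energy (fun t => (c t : W10 d) + ε • h t)) 0 0

end LipCurve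

end

open LipCurve

/-!
The energy of a path only involves the values of `G` on the open set of immersions, where `G` is a
`C¹` map `c ↦ G_c` into the bounded bilinear forms on `W^{1,∞}_0`, and the theorem is the
Euler–Lagrange equation of a `C¹` metric together with the identification of `Γ_c`.

*Regularity of the metric.* One has `G_c(u, v) = ℓ_c⁻¹ ∫ |c_θ|⁻¹ ⟨u_θ, v_θ⟩ dθ`, and `ℓ_c` is the
same integral with `u = v = c`. Everything therefore rests on the superposition operator
`a ↦ |a|⁻¹` on `L^∞`. On the open set where `ess inf |a| > 0`, the remainder of its first-order
expansion is pointwise quadratic (`abs_inv_norm_sub_sub_le`), which gives its Fréchet derivative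
`v ↦ -⟨|a|⁻³ a, v⟩` (`LInfty.hasFDerivAt_invNorm`), and this derivative is continuous in `a`.
Consequently (`LipCurve.hasFDerivAt_metricForm`)
`D_{c,v} G_c(u, w) = -G_c(c, v) G_c(u, w) - ℓ_c⁻¹ ∫ |c_θ|⁻³ ⟨c_θ, v_θ⟩ ⟨u_θ, w_θ⟩ dθ`.

*First variation.* For any symmetric `C¹` metric on an open subset of a normed space,
differentiating under the integral sign and integrating `∂_t (G_c(c_t, h))` over `[0, 1]` gives
`dE(c).h = ∫ (½ D_{c,h} G_c(c_t, c_t) - D_{c,c_t} G_c(c_t, h) - G_c(c_tt, h)) dt`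
(`FirstVariation.hasDerivAt_integral_metric_velocity`).

*Identification of `Γ`.* The linear form `h ↦ ½ D_{c,h} G_c(u, u) - D_{c,u} G_c(u, h)` is
`G_c(Γ_c(u), ·)` (`LipCurve.metricForm_geodesicRHS`). The projection `π₀` in `Γ` is invisible to
this pairing because `∫ h_θ dθ = 0`.

*Critical points.* `G` is a weak metric, so nondegeneracy in the sense of an isomorphism with the
dual is not available. It suffices that the defect `w(t) = Γ_c(c_t) - c_tt` takes values in
`W^{1,∞}_0`: testing with `h(t) = φ(t) w(t₀)`, `φ` smooth and scalar, gives
`G_{c(t₀)}(w(t₀), w(t₀)) = 0`, and `G` is positive definite.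
-/

/-! ### The first variation of the energy of a `C¹` metric -/

namespace FirstVariation

open Filter Topology

-- needed for the normed structure on the space of bounded trilinear forms
set_option maxSynthPendingDepth 3

variable {X : Type*} [NormedAddCommGroup X] [NormedSpace ℝ X]

/-- A compact path inside an open set stays there under small multiples of a bounded variation. -/
lemma exists_radius_add_smul_mem {U : Set X} (hU : IsOpen U) {c h : ℝ → X} {K : Set ℝ}
    (hK : IsCompact K) (hc : ContinuousOn c K) (hcU : ∀ t ∈ K, c t ∈ U) (hh : ContinuousOn h K) :
    ∃ r : ℝ, 0 < r ∧ ∀ ε : ℝ, |ε| ≤ r → ∀ t ∈ K, c t + ε • h t ∈ U := by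
  obtain ⟨δ, hδ, hsub⟩ := (hK.image_of_continuousOn hc).exists_cthickening_subset_open hU
    (image_subset_iff.2 hcU)
  obtain ⟨C, hC⟩ := hK.exists_bound_of_continuousOn hh
  have hC0 : 0 < |C| + 1 := by positivity
  refine ⟨δ / (|C| + 1), by positivity, fun ε hε t ht => hsub ?_⟩
  refine Metric.mem_cthickening_of_dist_le _ (c t) _ _ (mem_image_of_mem c ht) ?_
  rw [dist_eq_norm, add_sub_cancel_left, norm_smul, Real.norm_eq_abs]
  calc |ε| * ‖h t‖ ≤ δ / (|C| + 1) * (|C| + 1) := by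
        gcongr
        exact (hC t ht).trans ((le_abs_self C).trans (by linarith))
    _ = δ := div_mul_cancel₀ _ hC0.ne'

variable {U : Set X} {g : X → X →L[ℝ] X →L[ℝ] ℝ} {g' : X → X →L[ℝ] X →L[ℝ] X →L[ℝ] ℝ}

/-- The chain and product rules for `g(p)(u, v)` along curves `p, u, v` in `X`. -/
lemma hasDerivWithinAt_metric {p u v : ℝ → X} {p' u' v' : X} {s : Set ℝ} {x : ℝ}
    (hg : HasFDerivAt g (g' (p x)) (p x)) (hp : HasDerivWithinAt p p' s x)
    (hu : HasDerivWithinAt u u' s x) (hv : HasDerivWithinAt v v' s x) :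
    HasDerivWithinAt (fun y => g (p y) (u y) (v y))
      (g' (p x) p' (u x) (v x) + g (p x) u' (v x) + g (p x) (u x) v') s x := by
  have h0 : HasDerivWithinAt (fun y => g (p y)) (g' (p x) p') s x :=
    hg.comp_hasDerivWithinAt x hp
  have h1 : HasDerivWithinAt (fun y => g (p y) (u y)) (g' (p x) p' (u x) + g (p x) u') s x :=
    h0.clm_apply hu
  have h2 := h1.clm_apply hv
  simpa only [add_apply] using h2

variable {c h : ℝ → X}

/-- The derivative of `ε ↦ ∫ g(c + εh)(c' + εh', c' + εh') dt` at `ε = 0`, before the integration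
by parts. -/
lemma hasDerivAt_integral_metric (hU : IsOpen U) (hg : ∀ x ∈ U, HasFDerivAt g (g' x) x)
    (hg' : ContinuousOn g' U) {u k : ℝ → X} (hc : ContinuousOn c (Icc 0 1))
    (hcU : ∀ t ∈ Icc (0 : ℝ) 1, c t ∈ U) (hu : ContinuousOn u (Icc 0 1))
    (hh : ContinuousOn h (Icc 0 1)) (hk : ContinuousOn k (Icc 0 1)) :
    HasDerivAt (fun ε : ℝ => ∫ t in (0 : ℝ)..1,
        g (c t + ε • h t) (u t + ε • k t) (u t + ε • k t))
      (∫ t in (0 : ℝ)..1, (g' (c t) (h t) (u t) (u t) + g (c t) (k t) (u t) +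
        g (c t) (u t) (k t))) 0 := by
  obtain ⟨r, hr, hrU⟩ := exists_radius_add_smul_mem hU isCompact_Icc hc hcU hh
  have hgc : ContinuousOn g U := fun x hx => (hg x hx).continuousAt.continuousWithinAt
  set S : Set (ℝ × ℝ) := Metric.closedBall 0 r ×ˢ Icc 0 1
  have hsnd : MapsTo Prod.snd S (Icc (0 : ℝ) 1) := fun q hq => hq.2
  have hpert {a b : ℝ → X} (ha : ContinuousOn a (Icc 0 1)) (hb : ContinuousOn b (Icc 0 1)) :
      ContinuousOn (fun q : ℝ × ℝ => a q.2 + q.1 • b q.2) S :=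
    (ha.comp continuousOn_snd hsnd).add
      (continuousOn_fst.smul (hb.comp continuousOn_snd hsnd))
  have hmaps : MapsTo (fun q : ℝ × ℝ => c q.2 + q.1 • h q.2) S U := fun q hq =>
    hrU q.1 (by simpa [Real.dist_eq] using hq.1) q.2 hq.2
  have hP := hpert hc hh
  have hV := hpert hu hk
  have hk' : ContinuousOn (fun q : ℝ × ℝ => k q.2) S := hk.comp continuousOn_snd hsnd
  have hh' : ContinuousOn (fun q : ℝ × ℝ => h q.2) S := hh.comp continuousOn_snd hsnd
  have hgP : ContinuousOn (fun q : ℝ × ℝ => g (c q.2 + q.1 • h q.2)) S := hgc.comp hP hmaps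
  have hg'P : ContinuousOn (fun q : ℝ × ℝ => g' (c q.2 + q.1 • h q.2)) S := hg'.comp hP hmaps
  have hF : ContinuousOn (fun q : ℝ × ℝ => g (c q.2 + q.1 • h q.2) (u q.2 + q.1 • k q.2)
      (u q.2 + q.1 • k q.2)) S := (hgP.clm_apply hV).clm_apply hV
  have hF' : ContinuousOn (fun q : ℝ × ℝ =>
      g' (c q.2 + q.1 • h q.2) (h q.2) (u q.2 + q.1 • k q.2) (u q.2 + q.1 • k q.2) +
      g (c q.2 + q.1 • h q.2) (k q.2) (u q.2 + q.1 • k q.2) +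
      g (c q.2 + q.1 • h q.2) (u q.2 + q.1 • k q.2) (k q.2)) S :=
    ((((hg'P.clm_apply hh').clm_apply hV).clm_apply hV).add
      ((hgP.clm_apply hk').clm_apply hV)).add ((hgP.clm_apply hV).clm_apply hk')
  obtain ⟨C, hC⟩ :=
    ((isCompact_closedBall (0 : ℝ) r).prod isCompact_Icc).exists_bound_of_continuousOn hF'
  have hslice {f : ℝ × ℝ → ℝ} (hf : ContinuousOn f S) {ε : ℝ} (hε : ε ∈ Metric.closedBall 0 r) :
      ContinuousOn (fun t => f (ε, t)) (Icc 0 1) :=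
    hf.comp (by fun_prop) fun t ht => ⟨hε, ht⟩
  have hI : uIoc (0 : ℝ) 1 ⊆ Icc 0 1 := by
    rw [uIoc_of_le zero_le_one]; exact Ioc_subset_Icc_self
  have hmeas {f : ℝ → ℝ} (hf : ContinuousOn f (Icc 0 1)) :
      AEStronglyMeasurable f (volume.restrict (uIoc (0 : ℝ) 1)) :=
    (hf.aestronglyMeasurable measurableSet_Icc).mono_measure (Measure.restrict_mono hI le_rfl)
  have h0 : (0 : ℝ) ∈ Metric.closedBall (0 : ℝ) r := Metric.mem_closedBall_self hr.le
  have key := intervalIntegral.hasDerivAt_integral_of_dominated_loc_of_deriv_le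
    (μ := volume) (a := 0) (b := 1) (x₀ := (0 : ℝ)) (s := Metric.closedBall 0 r)
    (F := fun ε t => g (c t + ε • h t) (u t + ε • k t) (u t + ε • k t))
    (F' := fun ε t => g' (c t + ε • h t) (h t) (u t + ε • k t) (u t + ε • k t) +
      g (c t + ε • h t) (k t) (u t + ε • k t) + g (c t + ε • h t) (u t + ε • k t) (k t))
    (bound := fun _ => C)
    (Metric.closedBall_mem_nhds 0 hr)
    (by filter_upwards [Metric.closedBall_mem_nhds (0 : ℝ) hr] with ε hε using hmeas (hslice hF hε))
    ((hslice hF h0).intervalIntegrable_of_Icc zero_le_one)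
    (hmeas (hslice hF' h0))
    (Eventually.of_forall fun t ht ε hε => hC (ε, t) ⟨hε, hI ht⟩)
    intervalIntegrable_const
    (Eventually.of_forall fun t ht ε hε => by
      have hlin (a b : X) : HasDerivAt (fun y : ℝ => a + y • b) b ε := by
        simpa using ((hasDerivAt_id ε).smul_const b).const_add a
      rw [← hasDerivWithinAt_univ]
      exact hasDerivWithinAt_metric (p := fun y => c t + y • h t) (u := fun y => u t + y • k t)
        (v := fun y => u t + y • k t) (hg _ (hmaps (x := (ε, t)) ⟨hε, hI ht⟩))
        (hlin _ _).hasDerivWithinAt (hlin _ _).hasDerivWithinAt (hlin _ _).hasDerivWithinAt)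
  simpa using key.2

/-- The first variation formula: for a symmetric metric `g` of class `C¹` on an open set, the
derivative of `∫ g(c)(c', c') dt` in a direction `h` vanishing at the end points. -/
theorem hasDerivAt_integral_metric_velocity (hU : IsOpen U)
    (hg : ∀ x ∈ U, HasFDerivAt g (g' x) x) (hg' : ContinuousOn g' U)
    (hsymm : ∀ x v w, g x v w = g x w v)
    (hc : ContDiffOn ℝ 2 c (Icc 0 1)) (hcU : ∀ t ∈ Icc (0 : ℝ) 1, c t ∈ U)
    (hh : ContDiffOn ℝ 1 h (Icc 0 1)) (h0 : h 0 = 0) (h1 : h 1 = 0) :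
    HasDerivAt (fun ε : ℝ => ∫ t in (0 : ℝ)..1, g (c t + ε • h t)
        (derivWithin (fun s => c s + ε • h s) (Icc 0 1) t)
        (derivWithin (fun s => c s + ε • h s) (Icc 0 1) t))
      (∫ t in (0 : ℝ)..1,
        (g' (c t) (h t) (derivWithin c (Icc 0 1) t) (derivWithin c (Icc 0 1) t) -
          2 * g' (c t) (derivWithin c (Icc 0 1) t) (derivWithin c (Icc 0 1) t) (h t) -
          2 * g (c t) (derivWithin (derivWithin c (Icc 0 1)) (Icc 0 1) t) (h t))) 0 := by
  have hI : UniqueDiffOn ℝ (Icc (0 : ℝ) 1) := uniqueDiffOn_Icc zero_lt_one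
  set u := derivWithin c (Icc 0 1)
  set k := derivWithin h (Icc 0 1)
  set a := derivWithin u (Icc 0 1)
  have hu1 : ContDiffOn ℝ 1 u (Icc 0 1) := hc.derivWithin hI (by norm_num)
  have huc : ContinuousOn u (Icc 0 1) := hu1.continuousOn
  have hac : ContinuousOn a (Icc 0 1) := hu1.continuousOn_derivWithin hI le_rfl
  have hkc : ContinuousOn k (Icc 0 1) := hh.continuousOn_derivWithin hI le_rfl
  have hcd : ∀ t ∈ Icc (0 : ℝ) 1, HasDerivWithinAt c (u t) (Icc 0 1) t := fun t ht =>
    ((hc.differentiableOn (by norm_num)) t ht).hasDerivWithinAt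
  have hud : ∀ t ∈ Icc (0 : ℝ) 1, HasDerivWithinAt u (a t) (Icc 0 1) t := fun t ht =>
    ((hu1.differentiableOn (by norm_num)) t ht).hasDerivWithinAt
  have hhd : ∀ t ∈ Icc (0 : ℝ) 1, HasDerivWithinAt h (k t) (Icc 0 1) t := fun t ht =>
    ((hh.differentiableOn (by norm_num)) t ht).hasDerivWithinAt
  have hgc : ContinuousOn (fun t => g (c t)) (Icc 0 1) := ContinuousOn.comp
    (fun x hx => (hg x hx).continuousAt.continuousWithinAt) hc.continuousOn hcU
  have hg'c : ContinuousOn (fun t => g' (c t)) (Icc 0 1) := hg'.comp hc.continuousOn hcU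
  have hmain := hasDerivAt_integral_metric hU hg hg' hc.continuousOn hcU huc hh.continuousOn hkc
  -- integration by parts: `g(c)(c', h)` vanishes at both end points
  have hparts : ∫ t in (0 : ℝ)..1, (g' (c t) (u t) (u t) (h t) + g (c t) (a t) (h t) +
      g (c t) (u t) (k t)) = 0 := by
    have hcont : ContinuousOn (fun t => g' (c t) (u t) (u t) (h t) + g (c t) (a t) (h t) +
        g (c t) (u t) (k t)) (Icc 0 1) :=
      ((((hg'c.clm_apply huc).clm_apply huc).clm_apply hh.continuousOn).add
        ((hgc.clm_apply hac).clm_apply hh.continuousOn)).add ((hgc.clm_apply huc).clm_apply hkc)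
    have := intervalIntegral.integral_eq_sub_of_hasDerivAt_of_le (zero_le_one' ℝ)
      (f := fun t => g (c t) (u t) (h t)) ((hgc.clm_apply huc).clm_apply hh.continuousOn)
      (fun t ht => (hasDerivWithinAt_metric (hg _ (hcU t (Ioo_subset_Icc_self ht)))
        (hcd t (Ioo_subset_Icc_self ht)) (hud t (Ioo_subset_Icc_self ht))
        (hhd t (Ioo_subset_Icc_self ht))).hasDerivAt (Icc_mem_nhds ht.1 ht.2))
      (hcont.intervalIntegrable_of_Icc zero_le_one)
    rw [this, h0, h1]
    simp
  have hint1 : IntervalIntegrable (fun t => g' (c t) (h t) (u t) (u t) + g (c t) (k t) (u t) +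
      g (c t) (u t) (k t)) volume 0 1 := ContinuousOn.intervalIntegrable_of_Icc zero_le_one
    (((((hg'c.clm_apply hh.continuousOn).clm_apply huc).clm_apply huc).add
        ((hgc.clm_apply hkc).clm_apply huc)).add ((hgc.clm_apply huc).clm_apply hkc))
  have hint2 : IntervalIntegrable (fun t => g' (c t) (u t) (u t) (h t) + g (c t) (a t) (h t) +
      g (c t) (u t) (k t)) volume 0 1 := ContinuousOn.intervalIntegrable_of_Icc zero_le_one
    (((((hg'c.clm_apply huc).clm_apply huc).clm_apply hh.continuousOn).add
        ((hgc.clm_apply hac).clm_apply hh.continuousOn)).add ((hgc.clm_apply huc).clm_apply hkc))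
  convert! hmain using 1
  · funext ε
    refine intervalIntegral.integral_congr fun t ht => ?_
    rw [uIcc_of_le zero_le_one] at ht
    have : derivWithin (fun s => c s + ε • h s) (Icc 0 1) t = u t + ε • k t :=
      ((hcd t ht).add ((hhd t ht).const_smul ε)).derivWithin (hI t ht)
    simp only [this]
  · have hsub := intervalIntegral.integral_sub hint1 (hint2.const_mul 2)
    rw [intervalIntegral.integral_const_mul, hparts, mul_zero, sub_zero] at hsub
    rw [← hsub]
    refine intervalIntegral.integral_congr fun t _ => ?_
    simp only [hsymm (c t) (k t)]
    ring

/-- The fundamental lemma of the calculus of variations on `[0, 1]`. -/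
lemma eqOn_zero_of_integral_smooth_mul {f : ℝ → ℝ} (hf : ContinuousOn f (Icc 0 1))
    (h : ∀ φ : ℝ → ℝ, ContDiff ℝ ∞ φ → φ 0 = 0 → φ 1 = 0 → ∫ t in (0 : ℝ)..1, φ t * f t = 0) :
    ∀ t ∈ Icc (0 : ℝ) 1, f t = 0 := by
  have hae : ∀ᵐ t : ℝ, t ∈ Ioo (0 : ℝ) 1 → f t = 0 := by
    refine isOpen_Ioo.ae_eq_zero_of_integral_contDiff_smul_eq_zero
      ((hf.mono Ioo_subset_Icc_self).locallyIntegrableOn measurableSet_Ioo) ?_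
    intro φ hφ _ hsupp
    have hout : ∀ t ∉ Ioo (0 : ℝ) 1, φ t = 0 := fun t ht =>
      image_eq_zero_of_notMem_tsupport fun hm => ht (hsupp hm)
    have := h φ hφ (hout 0 (by simp)) (hout 1 (by simp))
    rw [intervalIntegral.integral_of_le zero_le_one, integral_Ioc_eq_integral_Ioo] at this
    rw [← setIntegral_eq_integral_of_forall_compl_eq_zero (s := Ioo 0 1)]
    · simpa using this
    · intro t ht
      rw [hout t ht, zero_smul]
  refine Measure.eqOn_Icc_of_ae_eq (μ := volume) zero_ne_one ?_ hf continuousOn_const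
  rw [← restrict_Ioo_eq_restrict_Icc]
  exact (ae_restrict_iff' measurableSet_Ioo).2 hae

end FirstVariation

/-! ### The superposition operators `a ↦ |a|⁻¹` and `a ↦ |a|⁻³ a` on `L^∞` -/

section Pointwise

variable {E : Type*} [NormedAddCommGroup E] [InnerProductSpace ℝ E]

/-- The remainder in the first-order expansion of `|·|⁻¹` is quadratic, uniformly on `|·| ≥ δ`.
The segment from `a` to `b` may pass through the origin. -/
lemma abs_inv_norm_sub_sub_le {δ : ℝ} (hδ : 0 < δ) {a b : E} (ha : δ ≤ ‖a‖) (hb : δ ≤ ‖b‖) :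
    |‖b‖⁻¹ - ‖a‖⁻¹ + ⟪(‖a‖ ^ 3)⁻¹ • a, b - a⟫| ≤ 2 / δ ^ 3 * ‖b - a‖ ^ 2 := by
  have hp : 0 < ‖a‖ := hδ.trans_le ha
  have hq : 0 < ‖b‖ := hδ.trans_le hb
  have hinner : ⟪a, b - a⟫ = (‖b‖ ^ 2 - ‖a‖ ^ 2 - ‖b - a‖ ^ 2) / 2 := by
    have := norm_add_sq_real a (b - a)
    rw [add_sub_cancel] at this
    linarith
  have he : (‖b‖ - ‖a‖) ^ 2 ≤ ‖b - a‖ ^ 2 :=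
    sq_le_sq' (by linarith [abs_le.1 (abs_norm_sub_norm_le b a)])
      (abs_le.1 (abs_norm_sub_norm_le b a)).2
  -- by polarization the remainder depends on the norms of `a`, `b` and `b - a` only, and it is
  -- a combination of the two small quantities `(‖b‖ - ‖a‖)²` and `‖b - a‖²`
  have hid : ‖b‖⁻¹ - ‖a‖⁻¹ + (‖a‖ ^ 3)⁻¹ * ((‖b‖ ^ 2 - ‖a‖ ^ 2 - ‖b - a‖ ^ 2) / 2) =
      (‖b‖ - ‖a‖) ^ 2 * (1 / (‖a‖ ^ 2 * ‖b‖) + 1 / (2 * ‖a‖ ^ 3)) -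
        ‖b - a‖ ^ 2 / (2 * ‖a‖ ^ 3) := by
    field_simp
    ring
  rw [real_inner_smul_left, hinner, hid]
  have h1 : 1 / (‖a‖ ^ 2 * ‖b‖) ≤ 1 / δ ^ 3 := by
    rw [pow_succ δ 2]; gcongr
  have h2 : 1 / (2 * ‖a‖ ^ 3) ≤ 1 / (2 * δ ^ 3) := by gcongr
  have h3 : ‖b - a‖ ^ 2 / (2 * ‖a‖ ^ 3) ≤ ‖b - a‖ ^ 2 * (1 / (2 * δ ^ 3)) := by
    rw [div_eq_mul_one_div]; gcongr
  have h4 : (‖b‖ - ‖a‖) ^ 2 * (1 / (‖a‖ ^ 2 * ‖b‖) + 1 / (2 * ‖a‖ ^ 3)) ≤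
      ‖b - a‖ ^ 2 * (1 / δ ^ 3 + 1 / (2 * δ ^ 3)) := by gcongr
  have h5 : 0 ≤ (‖b‖ - ‖a‖) ^ 2 * (1 / (‖a‖ ^ 2 * ‖b‖) + 1 / (2 * ‖a‖ ^ 3)) := by positivity
  have h6 : 0 ≤ ‖b - a‖ ^ 2 / (2 * ‖a‖ ^ 3) := by positivity
  have h7 : 2 / δ ^ 3 * ‖b - a‖ ^ 2 = ‖b - a‖ ^ 2 * (1 / δ ^ 3 + 1 / (2 * δ ^ 3)) +
      ‖b - a‖ ^ 2 * (1 / (2 * δ ^ 3)) := by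
    field_simp
    ring
  have h8 : 0 ≤ ‖b - a‖ ^ 2 * (1 / (2 * δ ^ 3)) := by positivity
  have h9 : 0 ≤ ‖b - a‖ ^ 2 * (1 / δ ^ 3 + 1 / (2 * δ ^ 3)) := by positivity
  rw [h7, abs_le]
  constructor <;> linarith

lemma norm_inv_cube_smul_sub_le {δ : ℝ} (hδ : 0 < δ) {a b : E} (ha : δ ≤ ‖a‖) (hb : δ ≤ ‖b‖) :
    ‖(‖b‖ ^ 3)⁻¹ • b - (‖a‖ ^ 3)⁻¹ • a‖ ≤ 4 / δ ^ 3 * ‖b - a‖ := by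
  have hp : 0 < ‖a‖ := hδ.trans_le ha
  have hq : 0 < ‖b‖ := hδ.trans_le hb
  have hsplit : (‖b‖ ^ 3)⁻¹ • b - (‖a‖ ^ 3)⁻¹ • a =
      (‖b‖ ^ 3)⁻¹ • (b - a) + ((‖b‖ ^ 3)⁻¹ - (‖a‖ ^ 3)⁻¹) • a := by
    rw [smul_sub, sub_smul]; abel
  have hid : ((‖b‖ ^ 3)⁻¹ - (‖a‖ ^ 3)⁻¹) * ‖a‖ = (‖a‖ - ‖b‖) *
      (1 / ‖b‖ ^ 3 + 1 / (‖a‖ * ‖b‖ ^ 2) + 1 / (‖a‖ ^ 2 * ‖b‖)) := by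
    field_simp
    ring
  have h1 : ‖(‖b‖ ^ 3)⁻¹ • (b - a)‖ ≤ 1 / δ ^ 3 * ‖b - a‖ := by
    rw [norm_smul, Real.norm_of_nonneg (by positivity), ← one_div]
    gcongr
  have h2 : ‖((‖b‖ ^ 3)⁻¹ - (‖a‖ ^ 3)⁻¹) • a‖ ≤ 3 / δ ^ 3 * ‖b - a‖ := by
    have hnorm (r : ℝ) : ‖r • a‖ = ‖r * ‖a‖‖ := by rw [norm_smul, norm_mul, norm_norm]
    rw [hnorm, hid, norm_mul, Real.norm_eq_abs, mul_comm, Real.norm_of_nonneg (by positivity)]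
    have e1 : 1 / ‖b‖ ^ 3 ≤ 1 / δ ^ 3 := by gcongr
    have e2 : 1 / (‖a‖ * ‖b‖ ^ 2) ≤ 1 / δ ^ 3 := by
      rw [pow_succ' δ 2]; gcongr
    have e3 : 1 / (‖a‖ ^ 2 * ‖b‖) ≤ 1 / δ ^ 3 := by
      rw [pow_succ δ 2]; gcongr
    have e4 : |‖a‖ - ‖b‖| ≤ ‖b - a‖ := by
      rw [norm_sub_rev]; exact abs_norm_sub_norm_le a b
    have e5 : 3 / δ ^ 3 = 1 / δ ^ 3 + 1 / δ ^ 3 + 1 / δ ^ 3 := by ring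
    rw [e5]
    gcongr
  rw [hsplit]
  refine (norm_add_le _ _).trans ((add_le_add h1 h2).trans (le_of_eq ?_))
  ring

end Pointwise

namespace LInfty

open Filter Topology

variable {α : Type*} {m : MeasurableSpace α} {μ : Measure α}
  {E : Type*} [NormedAddCommGroup E]

lemma ae_norm_le (f : Lp E ∞ μ) : ∀ᵐ x ∂μ, ‖f x‖ ≤ ‖f‖ := by
  have h1 := Lp.eLpNorm_lt_top f
  filter_upwards [ae_le_eLpNormEssSup (f := f) (μ := μ)] with x hx
  rw [Lp.norm_def, ← toReal_enorm (f x)]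
  rw [← eLpNorm_exponent_top] at hx
  exact ENNReal.toReal_mono h1.ne hx

lemma norm_le_of_ae_bound {f : Lp E ∞ μ} {C : ℝ} (hC : 0 ≤ C) (h : ∀ᵐ x ∂μ, ‖f x‖ ≤ C) :
    ‖f‖ ≤ C := by
  rw [Lp.norm_def, eLpNorm_exponent_top]
  refine ENNReal.toReal_le_of_le_ofReal hC ?_
  refine eLpNormEssSup_le_of_ae_bound h

/-- The set of those `a ∈ L^∞` with `ess inf |a| > 0`. -/
def awayFromZero (E : Type*) [NormedAddCommGroup E] (μ : Measure α) : Set (Lp E ∞ μ) :=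
  {a | ∃ δ : ℝ, 0 < δ ∧ ∀ᵐ x ∂μ, δ ≤ ‖a x‖}

lemma exists_uniform_lower_bound {a : Lp E ∞ μ} (ha : a ∈ awayFromZero E μ) :
    ∃ δ : ℝ, 0 < δ ∧ ∀ᶠ b in 𝓝 a, ∀ᵐ x ∂μ, δ ≤ ‖b x‖ := by
  obtain ⟨δ, hδ, h⟩ := ha
  refine ⟨δ / 2, half_pos hδ, ?_⟩
  filter_upwards [Metric.ball_mem_nhds a (half_pos hδ)] with b hb
  rw [Metric.mem_ball, dist_eq_norm] at hb
  filter_upwards [h, ae_norm_le (b - a), Lp.coeFn_sub b a] with x h1 h2 h3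
  rw [h3, Pi.sub_apply, norm_sub_rev] at h2
  have := norm_sub_norm_le (a x) (b x)
  linarith

lemma isOpen_awayFromZero : IsOpen (awayFromZero E μ) := by
  rw [isOpen_iff_mem_nhds]
  intro a ha
  obtain ⟨δ, hδ, h⟩ := exists_uniform_lower_bound ha
  filter_upwards [h] with b hb using ⟨δ, hδ, hb⟩

lemma memLp_inv_norm {a : Lp E ∞ μ} (ha : a ∈ awayFromZero E μ) :
    MemLp (fun x => ‖a x‖⁻¹) ∞ μ := by
  obtain ⟨δ, hδ, h⟩ := ha
  refine memLp_top_of_bound (Lp.aestronglyMeasurable a).norm.aemeasurable.inv.aestronglyMeasurable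
    δ⁻¹ ?_
  filter_upwards [h] with x hx
  rw [norm_inv, norm_norm]
  exact inv_anti₀ hδ hx

open Classical in
/-- The superposition operator `a ↦ |a|⁻¹` on `L^∞`, extended by zero to those `a` for which
`|a|⁻¹` is not essentially bounded. -/
noncomputable def invNorm (a : Lp E ∞ μ) : Lp ℝ ∞ μ :=
  if ha : a ∈ awayFromZero E μ then (memLp_inv_norm ha).toLp _ else 0

lemma coeFn_invNorm {a : Lp E ∞ μ} (ha : a ∈ awayFromZero E μ) :
    invNorm a =ᵐ[μ] fun x => ‖a x‖⁻¹ := by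
  rw [invNorm, dif_pos ha]
  exact (memLp_inv_norm ha).coeFn_toLp

variable [InnerProductSpace ℝ E]

lemma memLp_invCube {a : Lp E ∞ μ} (ha : a ∈ awayFromZero E μ) :
    MemLp (fun x => (‖a x‖ ^ 3)⁻¹ • a x) ∞ μ := by
  obtain ⟨δ, hδ, h⟩ := ha
  refine memLp_top_of_bound (((Lp.aestronglyMeasurable a).norm.pow
    3).aemeasurable.inv.aestronglyMeasurable.smul (Lp.aestronglyMeasurable a)) ((δ ^ 3)⁻¹ * ‖a‖) ?_
  filter_upwards [h, ae_norm_le a] with x hx hx'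
  rw [norm_smul, norm_inv, norm_pow, norm_norm]
  gcongr

open Classical in
/-- The superposition operator `a ↦ |a|⁻³ a` on `L^∞`, extended by zero to those `a` which are
not bounded away from zero. Up to sign it is the gradient of `a ↦ |a|⁻¹`. -/
noncomputable def invCube (a : Lp E ∞ μ) : Lp E ∞ μ :=
  if ha : a ∈ awayFromZero E μ then (memLp_invCube ha).toLp _ else 0

lemma coeFn_invCube {a : Lp E ∞ μ} (ha : a ∈ awayFromZero E μ) :
    invCube a =ᵐ[μ] fun x => (‖a x‖ ^ 3)⁻¹ • a x := by
  rw [invCube, dif_pos ha]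
  exact (memLp_invCube ha).coeFn_toLp

/-- The pointwise inner product `L^∞ × L^∞ → L^∞`. -/
noncomputable def pointwiseInner (E : Type*) [NormedAddCommGroup E] [InnerProductSpace ℝ E]
    (μ : Measure α) : Lp E ∞ μ →L[ℝ] Lp E ∞ μ →L[ℝ] Lp ℝ ∞ μ :=
  (innerSL ℝ : E →L[ℝ] E →L[ℝ] ℝ).holderL μ ∞ ∞ ∞

lemma coeFn_pointwiseInner (a b : Lp E ∞ μ) :
    pointwiseInner E μ a b =ᵐ[μ] fun x => ⟪a x, b x⟫ :=
  ContinuousLinearMap.coeFn_holder (innerSL ℝ : E →L[ℝ] E →L[ℝ] ℝ) a b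

lemma continuousOn_invCube : ContinuousOn (invCube (E := E) (μ := μ)) (awayFromZero E μ) := by
  intro a ha
  refine ContinuousAt.continuousWithinAt ?_
  obtain ⟨δ, hδ, h⟩ := exists_uniform_lower_bound ha
  rw [ContinuousAt, tendsto_iff_norm_sub_tendsto_zero]
  have hlim : Tendsto (fun b : Lp E ∞ μ => 4 / δ ^ 3 * ‖b - a‖) (𝓝 a) (𝓝 0) := by
    have : ContinuousAt (fun b : Lp E ∞ μ => 4 / δ ^ 3 * ‖b - a‖) a := by fun_prop
    simpa [ContinuousAt] using this
  refine squeeze_zero' (Eventually.of_forall fun b => norm_nonneg _) ?_ hlim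
  filter_upwards [h] with b hb
  refine norm_le_of_ae_bound (by positivity) ?_
  filter_upwards [hb, h.self_of_nhds, Lp.coeFn_sub (invCube b) (invCube a),
    coeFn_invCube ⟨δ, hδ, hb⟩, coeFn_invCube ha, ae_norm_le (b - a), Lp.coeFn_sub b a]
    with x h1 h2 h3 h4 h5 h6 h7
  rw [h3, Pi.sub_apply, h4, h5]
  rw [h7, Pi.sub_apply] at h6
  exact (norm_inv_cube_smul_sub_le hδ h2 h1).trans (by gcongr)

lemma hasFDerivAt_invNorm {a : Lp E ∞ μ} (ha : a ∈ awayFromZero E μ) :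
    HasFDerivAt invNorm (-pointwiseInner E μ (invCube a)) a := by
  obtain ⟨δ, hδ, h⟩ := exists_uniform_lower_bound ha
  rw [hasFDerivAt_iff_isLittleO]
  refine Asymptotics.IsBigO.trans_isLittleO (g := fun b => ‖b - a‖ ^ 2) ?_
    ((Asymptotics.isLittleO_norm_pow_id one_lt_two).comp_tendsto
      (tendsto_sub_nhds_zero_iff.2 tendsto_id))
  refine Asymptotics.IsBigO.of_bound (2 / δ ^ 3) ?_
  filter_upwards [h] with b hb
  rw [norm_pow, norm_norm]
  refine norm_le_of_ae_bound (by positivity) ?_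
  rw [neg_apply, sub_neg_eq_add]
  filter_upwards [hb, h.self_of_nhds, coeFn_invNorm ⟨δ, hδ, hb⟩, coeFn_invNorm ha,
    coeFn_invCube ha, coeFn_pointwiseInner (invCube a) (b - a),
    Lp.coeFn_add (invNorm b - invNorm a) (pointwiseInner E μ (invCube a) (b - a)),
    Lp.coeFn_sub (invNorm b) (invNorm a), ae_norm_le (b - a), Lp.coeFn_sub b a]
    with x h1 h2 h3 h4 h5 h6 h7 h8 h9 h10
  rw [h7, Pi.add_apply, h8, Pi.sub_apply, h3, h4, h6, h5, h10, Pi.sub_apply]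
  rw [h10, Pi.sub_apply] at h9
  exact (abs_inv_norm_sub_sub_le hδ h2 h1).trans (by gcongr)

end LInfty

/-! ### The metric `G` as a `C¹` map into bilinear forms -/

namespace LipCurve

open LInfty

-- needed for the normed structure on the space of bounded trilinear forms
set_option maxSynthPendingDepth 3

variable {d : ℕ}

/-- The derivative `h ↦ h_θ` as a bounded operator `W^{1,∞}_0 → L^∞`. -/
noncomputable def thetaDeriv (d : ℕ) : W10 d →L[ℝ] W0 d :=
  LinearMap.mkContinuous
    { toFun := fun h => (WithLp.ofLp (W1.graphMap d (h : W1 d))).2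
      map_add' := fun h k => by simp
      map_smul' := fun a h => by simp } 1 fun h => by
    rw [one_mul]
    have h1 : ‖(W1.memLp_dTheta (h : W1 d)).toLp _‖ =
        (eLpNorm (dTheta (h : W1 d)) ∞ (volume : Measure S1)).toReal := Lp.norm_toLp _ _
    have h2 := W1.norm_def (h : W1 d)
    change ‖(W1.memLp_dTheta (h : W1 d)).toLp _‖ ≤ ‖(h : W1 d)‖
    rw [h1, h2]
    exact le_add_of_nonneg_left (norm_nonneg _)

lemma coeFn_thetaDeriv (h : W10 d) : thetaDeriv d h =ᵐ[volume] dTheta (h : W1 d) :=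
  (W1.memLp_dTheta (h : W1 d)).coeFn_toLp

/-- The open set of curves `c` with `ess inf |c_θ| > 0`, as the preimage of an open subset of
`L^∞`. -/
def immersionSet (d : ℕ) : Set (W10 d) := thetaDeriv d ⁻¹' awayFromZero (Vec d) volume

lemma isOpen_immersionSet : IsOpen (immersionSet d) :=
  isOpen_awayFromZero.preimage (thetaDeriv d).continuous

lemma Imm0_subset_immersionSet : Imm0 d ⊆ immersionSet d := by
  intro c hc
  obtain ⟨δ, hδ, h⟩ := IsImmersion.exists_bound hc
  refine ⟨δ, hδ, ?_⟩
  filter_upwards [h, coeFn_thetaDeriv c] with x h1 h2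
  rw [h2]
  exact h1.le

lemma ae_dTheta_ne_zero {c : W10 d} (hc : c ∈ immersionSet d) :
    ∀ᵐ x : S1, 0 < ‖dTheta (c : W1 d) x‖ := by
  obtain ⟨δ, hδ, h⟩ := hc
  filter_upwards [h, coeFn_thetaDeriv c] with x h1 h2
  rw [← h2]
  exact hδ.trans_le h1

/-- The pairing `(f, k) ↦ ∫ f k dθ` on `L^∞`: the pointwise product, integrated by pairing it with
the constant `1` in `L¹`. -/
noncomputable def integralMul :
    Lp ℝ ∞ (volume : Measure S1) →L[ℝ] Lp ℝ ∞ (volume : Measure S1) →L[ℝ] ℝ :=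
  (ContinuousLinearMap.compL ℝ _ _ _
    (((ContinuousLinearMap.mul ℝ ℝ).lpPairing volume ∞ 1).flip (Lp.const 1 volume (1 : ℝ)))) ∘L
    ((ContinuousLinearMap.mul ℝ ℝ).holderL volume ∞ ∞ ∞)

lemma integralMul_apply (f k : Lp ℝ ∞ (volume : Measure S1)) :
    integralMul f k = ∫ x, f x * k x := by
  change (ContinuousLinearMap.mul ℝ ℝ).lpPairing volume ∞ 1
    ((ContinuousLinearMap.mul ℝ ℝ).holder ∞ f k) (Lp.const 1 volume (1 : ℝ)) = _
  rw [ContinuousLinearMap.lpPairing_eq_integral]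
  refine integral_congr_ae ?_
  filter_upwards [ContinuousLinearMap.coeFn_holder (r := ∞) (ContinuousLinearMap.mul ℝ ℝ) f k,
    Lp.coeFn_const (E := ℝ) (p := 1) (μ := (volume : Measure S1)) 1] with x h1 h2
  rw [h1, h2]
  simp

/-- The bilinear form `(u, v) ↦ ∫ f ⟨u_θ, v_θ⟩ dθ` with weight `f ∈ L^∞`. -/
noncomputable def weightedForm (d : ℕ) :
    Lp ℝ ∞ (volume : Measure S1) →L[ℝ] W10 d →L[ℝ] W10 d →L[ℝ] ℝ :=
  (ContinuousLinearMap.compL ℝ (W10 d) (W10 d →L[ℝ] Lp ℝ ∞ (volume : Measure S1))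
      (W10 d →L[ℝ] ℝ)).flip
    ((pointwiseInner (Vec d) volume).bilinearComp (thetaDeriv d) (thetaDeriv d)) ∘L
  ContinuousLinearMap.compL ℝ (W10 d) (Lp ℝ ∞ (volume : Measure S1)) ℝ ∘L integralMul

lemma weightedForm_apply (f : Lp ℝ ∞ (volume : Measure S1)) (u v : W10 d) :
    weightedForm d f u v = ∫ x, f x * ⟪dTheta (u : W1 d) x, dTheta (v : W1 d) x⟫ := by
  change integralMul f (pointwiseInner (Vec d) volume (thetaDeriv d u) (thetaDeriv d v)) = _
  rw [integralMul_apply]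
  refine integral_congr_ae ?_
  filter_upwards [coeFn_pointwiseInner (thetaDeriv d u) (thetaDeriv d v), coeFn_thetaDeriv u,
    coeFn_thetaDeriv v] with x h1 h2 h3
  rw [h1, h2, h3]

lemma integrable_weighted (f : Lp ℝ ∞ (volume : Measure S1)) (u v : W10 d) :
    Integrable (fun x => f x * ⟪dTheta (u : W1 d) x, dTheta (v : W1 d) x⟫) volume := by
  refine ((Lp.memLp ((ContinuousLinearMap.mul ℝ ℝ).holder ∞ f (pointwiseInner (Vec d) volume
    (thetaDeriv d u) (thetaDeriv d v)))).integrable le_top).congr ?_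
  filter_upwards [ContinuousLinearMap.coeFn_holder (r := ∞) (ContinuousLinearMap.mul ℝ ℝ) f
      (pointwiseInner (Vec d) volume (thetaDeriv d u) (thetaDeriv d v)),
    coeFn_pointwiseInner (thetaDeriv d u) (thetaDeriv d v), coeFn_thetaDeriv u,
    coeFn_thetaDeriv v] with x h0 h1 h2 h3
  rw [h0, h1, h2, h3]
  rfl

/-- The bilinear form `(u, v) ↦ ∫ ⟨D_s u, D_s v⟩ ds = ∫ |c_θ|⁻¹ ⟨u_θ, v_θ⟩ dθ` of an immersion `c`;
it is zero if `c` is not an immersion. -/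
noncomputable def arcForm (c : W10 d) : W10 d →L[ℝ] W10 d →L[ℝ] ℝ :=
  weightedForm d (invNorm (thetaDeriv d c))

/-- The trilinear form `(v, u, w) ↦ ∫ |c_θ|⁻³ ⟨c_θ, v_θ⟩ ⟨u_θ, w_θ⟩ dθ`. -/
noncomputable def cubicForm (c : W10 d) : W10 d →L[ℝ] W10 d →L[ℝ] W10 d →L[ℝ] ℝ :=
  weightedForm d ∘L pointwiseInner (Vec d) volume (invCube (thetaDeriv d c)) ∘L thetaDeriv d

lemma arcForm_apply {c : W10 d} (hc : c ∈ immersionSet d) (u v : W10 d) :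
    arcForm c u v =
      ∫ x, ‖dTheta (c : W1 d) x‖⁻¹ * ⟪dTheta (u : W1 d) x, dTheta (v : W1 d) x⟫ := by
  rw [arcForm, weightedForm_apply]
  refine integral_congr_ae ?_
  filter_upwards [coeFn_invNorm hc, coeFn_thetaDeriv c] with x h1 h2
  rw [h1, h2]

lemma cubicForm_apply {c : W10 d} (hc : c ∈ immersionSet d) (v u w : W10 d) :
    cubicForm c v u w = ∫ x, (‖dTheta (c : W1 d) x‖ ^ 3)⁻¹ *
      ⟪dTheta (c : W1 d) x, dTheta (v : W1 d) x⟫ *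
      ⟪dTheta (u : W1 d) x, dTheta (w : W1 d) x⟫ := by
  change weightedForm d (pointwiseInner (Vec d) volume (invCube (thetaDeriv d c))
    (thetaDeriv d v)) u w = _
  rw [weightedForm_apply]
  refine integral_congr_ae ?_
  filter_upwards [coeFn_invCube hc, coeFn_thetaDeriv c, coeFn_thetaDeriv v,
    coeFn_pointwiseInner (invCube (thetaDeriv d c)) (thetaDeriv d v)] with x h1 h2 h3 h4
  rw [h4, h1, h2, h3, real_inner_smul_left]

lemma arcForm_symm (c u v : W10 d) : arcForm c u v = arcForm c v u := by
  rw [arcForm, weightedForm_apply, weightedForm_apply]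
  simp only [real_inner_comm]

lemma cubicForm_self {c : W10 d} (hc : c ∈ immersionSet d) (v : W10 d) :
    cubicForm c v c c = arcForm c c v := by
  rw [cubicForm_apply hc, arcForm_apply hc]
  refine integral_congr_ae ?_
  filter_upwards [ae_dTheta_ne_zero hc] with x hx
  rw [real_inner_self_eq_norm_sq]
  field_simp

lemma hasFDerivAt_arcForm {c : W10 d} (hc : c ∈ immersionSet d) :
    HasFDerivAt arcForm (-cubicForm c) c := by
  have h1 := (hasFDerivAt_invNorm hc).comp c (thetaDeriv d).hasFDerivAt
  have h2 := (weightedForm d).hasFDerivAt.comp c h1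
  refine h2.congr_fderiv ?_
  ext v u w
  simp [cubicForm]

lemma continuousOn_cubicForm : ContinuousOn (cubicForm (d := d)) (immersionSet d) := by
  have h1 : ContinuousOn (fun c : W10 d => invCube (thetaDeriv d c)) (immersionSet d) :=
    continuousOn_invCube.comp (thetaDeriv d).continuous.continuousOn fun _ hc => hc
  have h2 : ContinuousOn (fun c : W10 d =>
      pointwiseInner (Vec d) volume (invCube (thetaDeriv d c))) (immersionSet d) :=
    (pointwiseInner (Vec d) volume).continuous.comp_continuousOn h1
  exact continuousOn_const.clm_comp (h2.clm_comp continuousOn_const)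

lemma len_eq_arcForm {c : W10 d} (hc : c ∈ immersionSet d) : len (c : W1 d) = arcForm c c c := by
  rw [arcForm_apply hc, len, arcInt]
  refine integral_congr_ae ?_
  filter_upwards [ae_dTheta_ne_zero hc] with x hx
  rw [real_inner_self_eq_norm_sq, smul_eq_mul]
  field_simp

lemma len_pos {c : W10 d} (hc : c ∈ immersionSet d) : 0 < len (c : W1 d) := by
  have h0 : len (c : W1 d) = ∫ x, ‖dTheta (c : W1 d) x‖ := by simp [len, arcInt]
  rw [h0, integral_pos_iff_support_of_nonneg (fun x => norm_nonneg _)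
    ((W1.norm_dTheta_memLp (c : W1 d)).integrable le_top)]
  have h1 : Function.support (fun x => ‖dTheta (c : W1 d) x‖) =ᵐ[volume] (univ : Set S1) := by
    rw [Filter.eventuallyEq_univ]
    filter_upwards [ae_dTheta_ne_zero hc] with x hx using hx.ne'
  rw [measure_congr h1, AddCircle.measure_univ]
  exact ENNReal.ofReal_pos.2 Real.two_pi_pos

/-- Since `∫ |c_θ|⁻³ ⟨c_θ, v_θ⟩ |c_θ|² dθ = ∫ ⟨D_s c, D_s v⟩ ds`, the length `∫ ⟨D_s c, D_s c⟩ ds`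
has the derivative `v ↦ ∫ ⟨D_s c, D_s v⟩ ds`. -/
lemma hasFDerivAt_arcForm_self {c : W10 d} (hc : c ∈ immersionSet d) :
    HasFDerivAt (fun b : W10 d => arcForm b b b) (arcForm c c) c := by
  have h1 := ((hasFDerivAt_arcForm hc).clm_apply (hasFDerivAt_id c)).clm_apply (hasFDerivAt_id c)
  refine h1.congr_fderiv ?_
  ext v
  simp [cubicForm_self hc, arcForm_symm c v c]

/-- The metric `G_c` of an immersion `c`, as a bounded bilinear form (see `G_eq_metricForm`). The
normalizing factor is the length, by `len_eq_arcForm`. -/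
noncomputable def metricForm (c : W10 d) : W10 d →L[ℝ] W10 d →L[ℝ] ℝ :=
  (arcForm c c c)⁻¹ • arcForm c

/-- The derivative of `c ↦ G_c`. -/
noncomputable def metricDeriv (c : W10 d) : W10 d →L[ℝ] W10 d →L[ℝ] W10 d →L[ℝ] ℝ :=
  -((arcForm c c c)⁻¹ • cubicForm c + (metricForm c c).smulRight (metricForm c))

lemma metricDeriv_apply (c v u w : W10 d) : metricDeriv c v u w =
    -((arcForm c c c)⁻¹ * cubicForm c v u w + metricForm c c v * metricForm c u w) := by
  simp [metricDeriv]

lemma metricForm_symm (c u v : W10 d) : metricForm c u v = metricForm c v u := by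
  simp [metricForm, arcForm_symm c u v]

lemma hasFDerivAt_metricForm {c : W10 d} (hc : c ∈ immersionSet d) :
    HasFDerivAt metricForm (metricDeriv c) c := by
  have hne : arcForm c c c ≠ 0 := by
    rw [← len_eq_arcForm hc]; exact (len_pos hc).ne'
  have h1 : HasFDerivAt (fun b : W10 d => (arcForm b b b)⁻¹)
      (-((arcForm c c c) ^ 2)⁻¹ • arcForm c c) c :=
    (hasDerivAt_inv hne).comp_hasFDerivAt (f := fun b : W10 d => arcForm b b b) c
      (hasFDerivAt_arcForm_self hc)
  have h2 := h1.smul (hasFDerivAt_arcForm hc)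
  refine h2.congr_fderiv ?_
  ext v u w
  simp [metricDeriv, metricForm]
  field_simp
  ring

lemma continuousOn_metricForm : ContinuousOn (metricForm (d := d)) (immersionSet d) := fun _ hc =>
  (hasFDerivAt_metricForm hc).continuousAt.continuousWithinAt

lemma continuousOn_metricDeriv : ContinuousOn (metricDeriv (d := d)) (immersionSet d) := by
  have h1 : ContinuousOn (fun c : W10 d => (arcForm c c c)⁻¹) (immersionSet d) := by
    refine ContinuousOn.inv₀ (fun c hc => (hasFDerivAt_arcForm_self
      hc).continuousAt.continuousWithinAt) fun c hc => ?_
    rw [← len_eq_arcForm hc]; exact (len_pos hc).ne'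
  have h2 : ContinuousOn (fun c : W10 d => metricForm c c) (immersionSet d) :=
    continuousOn_metricForm.clm_apply continuousOn_id
  have h3 : ContinuousOn (fun c : W10 d => (metricForm c c).smulRight (metricForm c))
      (immersionSet d) :=
    ((ContinuousLinearMap.smulRightL ℝ (W10 d)
      (W10 d →L[ℝ] W10 d →L[ℝ] ℝ)).continuous.comp_continuousOn h2).clm_apply
      continuousOn_metricForm
  exact ((h1.smul continuousOn_cubicForm).add h3).neg

lemma G_eq_metricForm {c : W10 d} (hc : c ∈ immersionSet d) (u v : W10 d) :
    G (c : W1 d) u v = metricForm c u v := by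
  rw [G, len_eq_arcForm hc]
  change _ = (arcForm c c c)⁻¹ * arcForm c u v
  congr 1
  rw [arcForm_apply hc, arcInt]
  refine integral_congr_ae ?_
  filter_upwards [ae_dTheta_ne_zero hc] with x hx
  rw [arcDeriv, arcDeriv, real_inner_smul_left, real_inner_smul_right, smul_eq_mul]
  field_simp


end LipCurve

/-! ### The geodesic equation -/

namespace LipCurve

open LInfty

-- needed for the normed structure on the space of bounded trilinear forms
set_option maxSynthPendingDepth 3

variable {d : ℕ}

lemma eq_zero_of_metricForm_self {c : W10 d} (hc : c ∈ immersionSet d) {u : W10 d}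
    (h : metricForm c u u = 0) : u = 0 := by
  have hne : (arcForm c c c)⁻¹ ≠ 0 := by
    rw [← len_eq_arcForm hc]; exact (inv_pos.2 (len_pos hc)).ne'
  have h1 : arcForm c u u = 0 := (mul_eq_zero.1 h).resolve_left hne
  rw [arcForm, weightedForm_apply, integral_eq_zero_iff_of_nonneg_ae ?_
    (integrable_weighted _ u u)] at h1
  · refine W10.eq_zero_of_dTheta u ?_
    filter_upwards [h1, ae_dTheta_ne_zero hc, coeFn_invNorm hc, coeFn_thetaDeriv c]
      with x h2 h3 h4 h5
    rw [h4, h5, Pi.zero_apply] at h2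
    exact inner_self_eq_zero.1 ((mul_eq_zero.1 h2).resolve_left (inv_pos.2 h3).ne')
  · filter_upwards [coeFn_invNorm hc] with x hx
    rw [hx, Pi.zero_apply]
    exact mul_nonneg (by positivity) real_inner_self_nonneg

/-- The projection `π₀` does not affect the pairing, because `∫ h_θ dθ = 0`. -/
lemma arcForm_DsEquiv_symm (c : Imm0 d) (k : W0 d) (h : W10 d) :
    arcForm (c : W10 d) ((DsEquiv c.1.1 c.2).symm (proj0 c.1.1 k)) h =
      ∫ x, ⟪k x, dTheta (h : W1 d) x⟫ := by
  have hc := Imm0_subset_immersionSet c.2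
  set w := (DsEquiv c.1.1 c.2).symm (proj0 c.1.1 k) with hw
  have hDs : Ds c.1.1 c.2 w = proj0 c.1.1 k := (DsEquiv c.1.1 c.2).apply_symm_apply _
  have hae := Ds_coe_ae c.1.1 c.2 w
  rw [hDs] at hae
  set b : Vec d := (len (c : W10 d).1)⁻¹ • arcInt (c : W10 d).1 k with hb
  have hint1 : Integrable (fun x => ⟪k x, dTheta (h : W1 d) x⟫) volume := by
    refine ((Lp.memLp (pointwiseInner (Vec d) volume k (thetaDeriv d h))).integrable
      le_top).congr ?_
    filter_upwards [coeFn_pointwiseInner k (thetaDeriv d h), coeFn_thetaDeriv h] with x h1 h2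
    rw [h1, h2]
  have hint2 : Integrable (dTheta (h : W1 d)) volume :=
    (W1.memLp_dTheta (h : W1 d)).integrable le_top
  have hb0 : ∫ x, ⟪b, dTheta (h : W1 d) x⟫ = 0 := by
    rw [integral_inner hint2, W1.integral_dTheta, inner_zero_right]
  rw [arcForm_apply hc, ← sub_zero (∫ x, ⟪k x, dTheta (h : W1 d) x⟫), ← hb0,
    ← integral_sub hint1 (hint2.const_inner b)]
  refine integral_congr_ae ?_
  filter_upwards [hae, proj0_coe_ae c.1.1 k] with x h1 h2
  rw [← inner_sub_left, ← h2, h1, arcDeriv, real_inner_smul_left]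

lemma integral_inner_geoDensity {c : W10 d} (hc : c ∈ immersionSet d) (u h : W10 d) :
    ∫ x, ⟪geoDensity (c : W1 d) u x, dTheta (h : W1 d) x⟫ =
      cubicForm c u u h - 1 / 2 * cubicForm c h u u := by
  change _ = weightedForm d (pointwiseInner (Vec d) volume (invCube (thetaDeriv d c))
    (thetaDeriv d u)) u h - 1 / 2 * weightedForm d (pointwiseInner (Vec d) volume
    (invCube (thetaDeriv d c)) (thetaDeriv d h)) u u
  rw [weightedForm_apply, weightedForm_apply, ← integral_const_mul,
    ← integral_sub (integrable_weighted _ _ _) ((integrable_weighted _ _ _).const_mul _)]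
  refine integral_congr_ae ?_
  filter_upwards [coeFn_invCube hc, coeFn_thetaDeriv c, coeFn_thetaDeriv u, coeFn_thetaDeriv h,
    coeFn_pointwiseInner (invCube (thetaDeriv d c)) (thetaDeriv d u),
    coeFn_pointwiseInner (invCube (thetaDeriv d c)) (thetaDeriv d h)] with x h1 h2 h3 h4 h5 h6
  rw [h5, h6, h1, h2, h3, h4, geoDensity, arcDeriv, arcDeriv, inner_sub_left, norm_smul, norm_inv,
    norm_norm]
  simp only [real_inner_smul_left, real_inner_smul_right, real_inner_self_eq_norm_sq]
  ring

/-- The vector `Γ_c(u)` represents the linear form `½ D_{c,h} G_c(u, u) - D_{c,u} G_c(u, h)` in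
`h`. -/
lemma metricForm_geodesicRHS (c : Imm0 d) (u h : W10 d) :
    metricForm (c : W10 d) (geodesicRHS c u) h =
      1 / 2 * metricDeriv (c : W10 d) h u u - metricDeriv (c : W10 d) u u h := by
  have hc := Imm0_subset_immersionSet c.2
  have hcorr : metricForm (c : W10 d)
      ((DsEquiv c.1.1 c.2).symm (proj0 c.1.1 ((memLp_geoDensity c.2 u.1).toLp _))) h =
      (arcForm c.1 c.1 c.1)⁻¹ * (cubicForm c.1 u u h - 1 / 2 * cubicForm c.1 h u u) := by
    change (arcForm c.1 c.1 c.1)⁻¹ * arcForm c.1 _ h = _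
    rw [arcForm_DsEquiv_symm, ← integral_inner_geoDensity hc]
    congr 1
    refine integral_congr_ae ?_
    filter_upwards [(memLp_geoDensity c.2 u.1).coeFn_toLp] with x hx
    rw [hx]
  rw [geodesicRHS, map_add, map_sub, map_smul, map_smul, add_apply, sub_apply, smul_apply,
    smul_apply, hcorr, G_eq_metricForm hc, G_eq_metricForm hc, metricDeriv_apply,
    metricDeriv_apply, smul_eq_mul, smul_eq_mul]
  ring

section Paths

variable {c : ℝ → Imm0 d} {h : ℝ → W10 d}

lemma G_geodesicRHS_sub (c : Imm0 d) (u a h : W10 d) :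
    G (d := d) c.1 (geodesicRHS c u - a : W10 d) h =
      1 / 2 * metricDeriv c.1 h u u - metricDeriv c.1 u u h - metricForm c.1 a h := by
  rw [G_eq_metricForm (Imm0_subset_immersionSet c.2), map_sub, sub_apply, metricForm_geodesicRHS]

lemma hasDerivAt_energy (hc : ContDiffOn ℝ 2 (fun t => (c t : W10 d)) (Icc 0 1))
    (hh : ContDiffOn ℝ 1 h (Icc 0 1)) (h0 : h 0 = 0) (h1 : h 1 = 0) :
    HasDerivAt (fun ε : ℝ => energy (fun t => (c t : W10 d) + ε • h t))
      (∫ t in (0 : ℝ)..1,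
        G (d := d) (c t).1
          (geodesicRHS (c t) (velocity (fun s => (c s : W10 d)) t) -
            acceleration (fun s => (c s : W10 d)) t : W10 d)
          (h t)) 0 := by
  have hcU : ∀ t ∈ Icc (0 : ℝ) 1, (c t : W10 d) ∈ immersionSet d := fun t _ =>
    Imm0_subset_immersionSet (c t).2
  have hvar := (FirstVariation.hasDerivAt_integral_metric_velocity isOpen_immersionSet
    (fun x hx => hasFDerivAt_metricForm hx) continuousOn_metricDeriv metricForm_symm hc hcU hh
    h0 h1).const_mul (1 / 2 : ℝ)
  refine (hvar.congr_deriv ?_).congr_of_eventuallyEq ?_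
  · rw [← intervalIntegral.integral_const_mul]
    refine intervalIntegral.integral_congr fun t _ => ?_
    have hvel : velocity (fun s => (c s : W10 d)) =
      derivWithin (fun s => (c s : W10 d)) (Icc 0 1) := rfl
    have hacc : acceleration (fun s => (c s : W10 d)) =
      derivWithin (derivWithin (fun s => (c s : W10 d)) (Icc 0 1)) (Icc 0 1) := rfl
    simp only [G_geodesicRHS_sub, hvel, hacc]
    ring
  · -- the perturbed path consists of immersions once `ε` is small
    obtain ⟨r, hr, hrU⟩ := FirstVariation.exists_radius_add_smul_mem isOpen_immersionSet
      isCompact_Icc hc.continuousOn hcU hh.continuousOn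
    filter_upwards [Metric.closedBall_mem_nhds (0 : ℝ) hr] with ε hε
    rw [energy]
    congr 1
    refine intervalIntegral.integral_congr fun t ht => ?_
    rw [uIcc_of_le zero_le_one] at ht
    exact G_eq_metricForm (hrU ε (by simpa [Real.dist_eq] using hε) t ht) _ _

lemma continuousOn_metric_geodesic_defect
    (hc : ContDiffOn ℝ 2 (fun t => (c t : W10 d)) (Icc 0 1)) (w : W10 d) :
    ContinuousOn (fun t => G (d := d) (c t).1
      (geodesicRHS (c t) (velocity (fun s => (c s : W10 d)) t) -
        acceleration (fun s => (c s : W10 d)) t : W10 d) w) (Icc 0 1) := by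
  have hI : UniqueDiffOn ℝ (Icc (0 : ℝ) 1) := uniqueDiffOn_Icc zero_lt_one
  have hu1 : ContDiffOn ℝ 1 (velocity fun s => (c s : W10 d)) (Icc 0 1) :=
    hc.derivWithin hI (by norm_num)
  have huc := hu1.continuousOn
  have hac : ContinuousOn (acceleration fun s => (c s : W10 d)) (Icc 0 1) :=
    hu1.continuousOn_derivWithin hI le_rfl
  have hcU : MapsTo (fun t => (c t : W10 d)) (Icc 0 1) (immersionSet d) := fun t _ =>
    Imm0_subset_immersionSet (c t).2
  have hg := continuousOn_metricForm.comp hc.continuousOn hcU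
  have hg' := continuousOn_metricDeriv.comp hc.continuousOn hcU
  simp only [G_geodesicRHS_sub]
  exact ((continuousOn_const.mul (((hg'.clm_apply continuousOn_const).clm_apply huc).clm_apply
    huc)).sub (((hg'.clm_apply huc).clm_apply huc).clm_apply continuousOn_const)).sub
    ((hg.clm_apply hac).clm_apply continuousOn_const)

/-- Testing with the variations `φ(t) w`, for a scalar function `φ` and a fixed vector `w`, shows
that `G_c(Γ_c(c_t) - c_tt, w)` vanishes identically along a geodesic. -/
lemma IsGeodesic.metric_defect_eq_zero (hgeo : IsGeodesic c)
    (hc : ContDiffOn ℝ 2 (fun t => (c t : W10 d)) (Icc 0 1)) (w : W10 d) :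
    ∀ t ∈ Icc (0 : ℝ) 1, G (d := d) (c t).1
      (geodesicRHS (c t) (velocity (fun s => (c s : W10 d)) t) -
        acceleration (fun s => (c s : W10 d)) t : W10 d) w = 0 := by
  refine FirstVariation.eqOn_zero_of_integral_smooth_mul
    (continuousOn_metric_geodesic_defect hc w) fun φ hφ h0 h1 => ?_
  have hsmooth : ContDiffOn ℝ ∞ (fun t => φ t • w) (Icc 0 1) :=
    hφ.contDiffOn.smul contDiffOn_const
  have hh0 : φ 0 • w = 0 := by rw [h0, zero_smul]
  have hh1 : φ 1 • w = 0 := by rw [h1, zero_smul]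
  have hd := hasDerivAt_energy (h := fun t => φ t • w) hc
    (hsmooth.of_le (by exact_mod_cast le_top)) hh0 hh1
  refine Eq.trans ?_ (hd.unique (hgeo (fun t => φ t • w) hsmooth hh0 hh1))
  refine intervalIntegral.integral_congr fun t _ => ?_
  simp only [G_eq_metricForm (Imm0_subset_immersionSet (c t).2), map_smul, smul_eq_mul]

theorem isGeodesic_iff (hc : ContDiffOn ℝ 2 (fun t => (c t : W10 d)) (Icc 0 1)) :
    IsGeodesic c ↔ ∀ t ∈ Icc (0 : ℝ) 1,
      acceleration (fun s => (c s : W10 d)) t =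
        geodesicRHS (c t) (velocity (fun s => (c s : W10 d)) t) := by
  constructor
  · intro hgeo t ht
    have h1 := hgeo.metric_defect_eq_zero hc
      (geodesicRHS (c t) (velocity (fun s => (c s : W10 d)) t) -
        acceleration (fun s => (c s : W10 d)) t) t ht
    rw [G_eq_metricForm (Imm0_subset_immersionSet (c t).2)] at h1
    exact (sub_eq_zero.1
      (eq_zero_of_metricForm_self (Imm0_subset_immersionSet (c t).2) h1)).symm
  · intro heq h hh h0 h1
    refine (hasDerivAt_energy hc (hh.of_le (by exact_mod_cast le_top)) h0 h1).congr_deriv ?_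
    rw [intervalIntegral.integral_congr (g := fun _ => (0 : ℝ)), intervalIntegral.integral_zero]
    intro t ht
    rw [uIcc_of_le zero_le_one] at ht
    simp only [heq t ht, sub_self, G_eq_metricForm (Imm0_subset_immersionSet (c t).2), map_zero,
      zero_apply]

end Paths

end LipCurve

theorem mainTheorem4 {d : ℕ} (hd : 2 ≤ d) (c : ℝ → Imm0 d)
    (hc : ContDiffOn ℝ 2 (fun t => (c t : W10 d)) (Icc 0 1)) :
    (∀ h : ℝ → W10 d, ContDiffOn ℝ 1 h (Icc 0 1) → h 0 = 0 → h 1 = 0 →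
      HasDerivAt (fun ε : ℝ => energy (fun t => (c t : W10 d) + ε • h t))
        (∫ t in (0 : ℝ)..1,
          G (d := d) (c t).1
            (geodesicRHS (c t) (velocity (fun s => (c s : W10 d)) t) -
              acceleration (fun s => (c s : W10 d)) t : W10 d)
            (h t)) 0) ∧
    (IsGeodesic c ↔ ∀ t ∈ Icc (0 : ℝ) 1,
      acceleration (fun s => (c s : W10 d)) t =
        geodesicRHS (c t) (velocity (fun s => (c s : W10 d)) t)) := by
  exact ⟨fun h hh h0 h1 => hasDerivAt_energy hc hh h0 h1, isGeodesic_iff hc⟩
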